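/- \textbf{Conventions.} A \emph{lax monoidal structure} on a category is a functor $\otimes$, a unit object $U$ with natural isomorphisms $U\otimes X\cong X\cong X\otimes U$, and a natural transformation $\alpha_{XYZ}\colon (X\otimes Y)\otimes Z\to X\otimes(Y\otimes Z)$, not necessarily invertible, satisfying the pentagon equation and the triangle equations for a unit in the left, middle or right position. An \emph{$N$-fold lax monoidal category} is a category with lax monoidal structures $(\otimes_i,U_i,\alpha^i)$, $1\le i\le N$ (the units may differ), and, for $i<j$, natural transformations $$\eta^{ij}_{ABCD}\colon (A\otimes_j B)\otimes_i(C\otimes_j D)\to(A\otimes_i C)\otimes_j(B\otimes_i D)$$ and maps $\delta^{ij}\colon U_i\to U_i\otimes_j U_i$, $\mu^{ij}\colon U_j\otimes_i U_j\to U_j$, such that the following hold: the internal unit conditions ($\eta^{ij}_{ABU_iU_i}$ and $\eta^{ij}_{U_iU_iAB}$, precomposed with $\delta^{ij}$, are the identity up to the unit isomorphisms of $\otimes_i$); the external unit conditions ($\eta^{ij}_{AU_jBU_j}$ and $\eta^{ij}_{U_jAU_jB}$, postcomposed with $\mu^{ij}$, are the identity up to the unit isomorphisms of $\otimes_j$);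 the internal and external associativity conditions for $\eta^{ij}$; and, for $i<j<k$, the giant hexagon condition, i.e. the two composites of interchanges from $((A\otimes_kA')\otimes_j(B\otimes_kB'))\otimes_i((C\otimes_kC')\otimes_j(D\otimes_kD'))$ to $((A\otimes_iC)\otimes_j(B\otimes_iD))\otimes_k((A'\otimes_iC')\otimes_j(B'\otimes_iD'))$ agree. An \emph{$n$-fold monoidal category} is one in which all associators are invertible, all units are the same object $I$, and all $\delta^{ij},\mu^{ij}$ are the canonical isomorphisms $I\cong I\otimes_j I$, $I\otimes_i I\cong I$. \textbf{Theorem.} Let $n\ge m\ge 2$ and let $\mathcal V$ be an $n$-fold monoidal category with (set-indexed) coproducts such that all functors $A\otimes_i-$ and $-\otimes_i A$, $1\le i\le n$, preserve coproducts. Suppose that $(\mathcal V,\sqcup,\otimes_3,\dots,\otimes_n)$ is $(n-1)$-fold monoidal in the above sense, where $\sqcup$ has its standard monoidal structure with unit the initial object $\emptyset$, and $\otimes_3,\dots,\otimes_n$ keep their unit $I$, associators and interchanges. Then the category $\mathrm{Col}_m(\mathcal V)$ of sequences $(\mathcal C(j))_{j\ge0}$ of objects of $\mathcal V$ carries the structure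 of an $(n-m+1)$-fold lax monoidal category with products $$(\mathcal B\,\hat\otimes_1\,\mathcal C)(j)=\coprod_{k\ge0,\ j_1+\dots+j_k=j}\mathcal B(k)\otimes_{m-1}(\mathcal C(j_1)\otimes_m\dots\otimes_m\mathcal C(j_k))$$ (the empty $\otimes_m$-product being $I$), with unit $\mathcal I=(\emptyset,I,\emptyset,\emptyset,\dots)$, and $$(\mathcal B\,\hat\otimes_{i+1}\,\mathcal C)(j)=\mathcal B(j)\otimes_{m+i}\mathcal C(j),\qquad 1\le i\le n-m,$$ with unit $\mathcal M=(I,I,\dots)$. Moreover, the structure can be chosen such that: the associator of $\hat\otimes_1$ is, on each summand, the one induced by $\alpha^{m-1}$, regrouping by $\alpha^m$, and $\eta^{(m-1)m}$; the interchange from $\hat\otimes_1$ to $\hat\otimes_{i+1}$ is, on each summand, the one induced by $\eta^{m,m+i}$ and then $\eta^{m-1,m+i}$, followed by the inclusions into the coproducts; the associators, unit isomorphisms, interchanges and unit comparisons of the remaining products are levelwise those of $\mathcal V$; all comparison maps $\delta$, in particular $\mathcal I\to\mathcal I\,\hat\otimes_{i+1}\,\mathcal I$, are isomorphisms; and, if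 the comparison maps $\mu$ of $(\mathcal V,\sqcup,\otimes_3,\dots,\otimes_n)$ (such as $I\sqcup I\to I$) are isomorphisms, then so are all comparison maps $\mu$ of $\mathrm{Col}_m(\mathcal V)$, in particular $\mathcal M\,\hat\otimes_1\,\mathcal M\to\mathcal M$. -/

import Mathlib

open CategoryTheory CategoryTheory.Limits

universe v u

namespace IterMon

variable {C : Type u} [Category.{v} C]

/-- A multiplication on a category, that is, a functor `C × C ⥤ C`. -/
structure Product (C : Type u) [Category.{v} C] where
  obj : C → C → C
  hom : ∀ {X X' Y Y' : C}, (X ⟶ X') → (Y ⟶ Y') → (obj X Y ⟶ obj X' Y')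
  hom_id : ∀ X Y : C, hom (𝟙 X) (𝟙 Y) = 𝟙 (obj X Y)
  hom_comp : ∀ {X X' X'' Y Y' Y'' : C} (f : X ⟶ X') (f' : X' ⟶ X'') (g : Y ⟶ Y') (g' : Y' ⟶ Y''),
    hom (f ≫ f') (g ≫ g') = hom f g ≫ hom f' g'

/-- The functor `A ⊗ -`. -/
def Product.left (T : Product C) (A : C) : C ⥤ C where
  obj X := T.obj A X
  map f := T.hom (𝟙 A) f
  map_id X := T.hom_id A X
  map_comp f g := by rw [← T.hom_comp, Category.comp_id]

/-- The functor `- ⊗ A`. -/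
def Product.right (T : Product C) (A : C) : C ⥤ C where
  obj X := T.obj X A
  map f := T.hom f (𝟙 A)
  map_id X := T.hom_id X A
  map_comp f g := by rw [← T.hom_comp, Category.comp_id]

/-- A lax monoidal structure on `C` with product `T` and unit object `U`: the unit is a two-sided
unit up to coherent isomorphism, and the associator is a natural transformation, not necessarily
invertible, which satisfies the pentagon equation and is compatible with the unit. -/
structure LaxMonoidal (T : Product C) (U : C) where
  assoc : ∀ X Y Z : C, T.obj (T.obj X Y) Z ⟶ T.obj X (T.obj Y Z)
  leftUnitor : ∀ X : C, T.obj U X ≅ X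
  rightUnitor : ∀ X : C, T.obj X U ≅ X
  assoc_naturality : ∀ {X X' Y Y' Z Z' : C} (f : X ⟶ X') (g : Y ⟶ Y') (h : Z ⟶ Z'),
    T.hom (T.hom f g) h ≫ assoc X' Y' Z' = assoc X Y Z ≫ T.hom f (T.hom g h)
  leftUnitor_naturality : ∀ {X X' : C} (f : X ⟶ X'),
    T.hom (𝟙 U) f ≫ (leftUnitor X').hom = (leftUnitor X).hom ≫ f
  rightUnitor_naturality : ∀ {X X' : C} (f : X ⟶ X'),
    T.hom f (𝟙 U) ≫ (rightUnitor X').hom = (rightUnitor X).hom ≫ f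
  pentagon : ∀ W X Y Z : C,
    T.hom (assoc W X Y) (𝟙 Z) ≫ assoc W (T.obj X Y) Z ≫ T.hom (𝟙 W) (assoc X Y Z) =
      assoc (T.obj W X) Y Z ≫ assoc W X (T.obj Y Z)
  triangle : ∀ X Y : C,
    assoc X U Y ≫ T.hom (𝟙 X) (leftUnitor Y).hom = T.hom (rightUnitor X).hom (𝟙 Y)
  triangle_left : ∀ X Y : C,
    assoc U X Y ≫ (leftUnitor (T.obj X Y)).hom = T.hom (leftUnitor X).hom (𝟙 Y)
  triangle_right : ∀ X Y : C,
    assoc X Y U ≫ T.hom (𝟙 X) (rightUnitor Y).hom = (rightUnitor (T.obj X Y)).hom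

/-- Interchange data from a product `S` with unit `U` to a product `T` with unit `U'`:
a natural transformation `η`, together with comparison maps for the two units. (If all units are
the same strict unit, then the comparison maps are identities.) -/
structure Interchange (S : Product C) (U : C) (T : Product C) (U' : C) where
  η : ∀ X Y Z W : C,
    S.obj (T.obj X Y) (T.obj Z W) ⟶ T.obj (S.obj X Z) (S.obj Y W)
  η_naturality : ∀ {X X' Y Y' Z Z' W W' : C}
    (f : X ⟶ X') (g : Y ⟶ Y') (h : Z ⟶ Z') (k : W ⟶ W'),
    S.hom (T.hom f g) (T.hom h k) ≫ η X' Y' Z' W' =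
      η X Y Z W ≫ T.hom (S.hom f h) (S.hom g k)
  δ : U ⟶ T.obj U U
  μ : S.obj U' U' ⟶ U'

/-- The axioms on the interchange from a lax monoidal structure `(S, U)` to a lax monoidal
structure `(T, U')`. -/
structure Interchange.Coherent {S T : Product C} {U U' : C}
    (e : Interchange S U T U') (M : LaxMonoidal S U) (N : LaxMonoidal T U') : Prop where
  internal_unit_right : ∀ A B : C,
    S.hom (𝟙 (T.obj A B)) e.δ ≫ e.η A B U U ≫
      T.hom (M.rightUnitor A).hom (M.rightUnitor B).hom = (M.rightUnitor (T.obj A B)).hom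
  internal_unit_left : ∀ A B : C,
    S.hom e.δ (𝟙 (T.obj A B)) ≫ e.η U U A B ≫
      T.hom (M.leftUnitor A).hom (M.leftUnitor B).hom = (M.leftUnitor (T.obj A B)).hom
  external_unit_right : ∀ A B : C,
    e.η A U' B U' ≫ T.hom (𝟙 (S.obj A B)) e.μ ≫ (N.rightUnitor (S.obj A B)).hom =
      S.hom (N.rightUnitor A).hom (N.rightUnitor B).hom
  external_unit_left : ∀ A B : C,
    e.η U' A U' B ≫ T.hom e.μ (𝟙 (S.obj A B)) ≫ (N.leftUnitor (S.obj A B)).hom =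
      S.hom (N.leftUnitor A).hom (N.leftUnitor B).hom
  internal_assoc : ∀ A B X Y Z W : C,
    S.hom (e.η A B X Y) (𝟙 (T.obj Z W)) ≫ e.η (S.obj A X) (S.obj B Y) Z W ≫
        T.hom (M.assoc A X Z) (M.assoc B Y W) =
      M.assoc (T.obj A B) (T.obj X Y) (T.obj Z W) ≫
        S.hom (𝟙 (T.obj A B)) (e.η X Y Z W) ≫ e.η A B (S.obj X Z) (S.obj Y W)
  external_assoc : ∀ A B X Y Z W : C,
    e.η (T.obj A B) X (T.obj Y Z) W ≫ T.hom (e.η A B Y Z) (𝟙 (S.obj X W)) ≫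
        N.assoc (S.obj A Y) (S.obj B Z) (S.obj X W) =
      S.hom (N.assoc A B X) (N.assoc Y Z W) ≫ e.η A (T.obj B X) Y (T.obj Z W) ≫
        T.hom (𝟙 (S.obj A Y)) (e.η B X Z W)

/-- The giant hexagon for three products `S`, `T`, `R`, in this order. -/
def Hexagon {S T R : Product C} {U U' U'' : C} (e : Interchange S U T U')
    (f : Interchange T U' R U'') (g : Interchange S U R U'') : Prop :=
  ∀ A A' B B' X X' Y Y' : C,
    S.hom (f.η A A' B B') (f.η X X' Y Y') ≫
        g.η (T.obj A B) (T.obj A' B') (T.obj X Y) (T.obj X' Y') ≫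
        R.hom (e.η A B X Y) (e.η A' B' X' Y') =
      e.η (R.obj A A') (R.obj B B') (R.obj X X') (R.obj Y Y') ≫
        T.hom (g.η A A' X X') (g.η B B' Y Y') ≫
        f.η (S.obj A X) (S.obj A' X') (S.obj B Y) (S.obj B' Y')

/-- An `n`-fold lax monoidal category with products `T 0, …, T (n - 1)`, whose units
`U 0, …, U (n - 1)` may differ. -/
structure LaxIterated {n : ℕ} (T : Fin n → Product C) (U : Fin n → C) where
  mon : ∀ i, LaxMonoidal (T i) (U i)
  ic : ∀ i j, i < j → Interchange (T i) (U i) (T j) (U j)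
  coherent : ∀ i j (h : i < j), (ic i j h).Coherent (mon i) (mon j)
  hexagon : ∀ i j k (hij : i < j) (hjk : j < k),
    Hexagon (ic i j hij) (ic j k hjk) (ic i k (hij.trans hjk))

/-- An `n`-fold monoidal category: all products have the same unit, all associators are
invertible, and the unit comparisons are the canonical identifications `I ⊗ I ≅ I`. -/
structure IteratedMonoidal (n : ℕ) (C : Type u) [Category.{v} C] where
  T : Fin n → Product C
  I : C
  str : LaxIterated T (fun _ => I)
  assoc_isIso : ∀ i X Y Z, IsIso ((str.mon i).assoc X Y Z)
  δ_eq : ∀ i j h, (str.ic i j h).δ = ((str.mon j).leftUnitor I).inv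
  μ_eq : ∀ i j h, (str.ic i j h).μ = ((str.mon i).leftUnitor I).hom

/-- All functors `A ⊗ᵢ -` and `- ⊗ᵢ A` preserve (set-indexed) coproducts. -/
def IteratedMonoidal.PreservesCoproducts {n : ℕ} (V : IteratedMonoidal n C) : Prop :=
  ∀ (i : Fin n) (A : C) (J : Type),
    PreservesColimitsOfShape (Discrete J) ((V.T i).left A) ∧
      PreservesColimitsOfShape (Discrete J) ((V.T i).right A)

/-- The products `⊗_{m+1}, …, ⊗_n` (the products of `V` being numbered `1, …, n`). -/
def IteratedMonoidal.upper {n : ℕ} (_V : IteratedMonoidal n C) (m : ℕ) (i : Fin (n - m)) :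
    Fin n :=
  ⟨m + i, by omega⟩

theorem IteratedMonoidal.upper_lt {n : ℕ} (V : IteratedMonoidal n C) (m : ℕ)
    {i j : Fin (n - m)} (h : i < j) : V.upper m i < V.upper m j :=
  Nat.add_lt_add_left h m

section Coproducts

variable [HasCoproducts.{0} C]

instance hasFiniteCoproducts : HasFiniteCoproducts C :=
  hasFiniteCoproducts_of_hasCoproducts.{0} C

/-- The binary coproduct as a product on `C`. -/
noncomputable def coprodProduct (C : Type u) [Category.{v} C] [HasCoproducts.{0} C] :
    Product C where
  obj X Y := X ⨿ Y
  hom f g := coprod.map f g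
  hom_id _ _ := coprod.map_id_id
  hom_comp f f' g g' := (coprod.map_map f g f' g').symm

/-- The structure of an `(n-1)`-fold monoidal category on `(C, ⊔, ⊗₃, …, ⊗ₙ)`. The unit for `⊔` is
the initial object and the unit for `⊗₃, …, ⊗ₙ` is `I`. The monoidal structure of `⊔` is the
standard one, and `⊗₃, …, ⊗ₙ` keep their monoidal structures and interchanges. -/
structure IteratedMonoidal.CoproductExtension {n : ℕ} (V : IteratedMonoidal n C) where
  str : LaxIterated
    (Fin.cons (coprodProduct C) (fun i => V.T (V.upper 2 i)) : Fin (n - 2 + 1) → Product C)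
    (Fin.cons (⊥_ C) (fun _ => V.I) : Fin (n - 2 + 1) → C)
  assoc_zero : ∀ X Y Z : C, (str.mon 0).assoc X Y Z = (coprod.associator X Y Z).hom
  leftUnitor_zero : ∀ X : C, (str.mon 0).leftUnitor X = coprod.leftUnitor X
  rightUnitor_zero : ∀ X : C, (str.mon 0).rightUnitor X = coprod.rightUnitor X
  mon_succ : ∀ i : Fin (n - 2), str.mon i.succ = V.str.mon (V.upper 2 i)
  ic_succ : ∀ (i j : Fin (n - 2)) (h : i < j),
    str.ic i.succ j.succ (Fin.succ_lt_succ_iff.mpr h) =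
      V.str.ic (V.upper 2 i) (V.upper 2 j) (V.upper_lt 2 h)

end Coproducts

/-! ### Collections -/

/-- Collections in `C`: functors from the discrete category of natural numbers to `C`. -/
abbrev Collection (C : Type u) : Type u := ℕ → C

/-- The levelwise (fibrewise) product of collections. -/
def levelProduct (T : Product C) : Product (Collection C) where
  obj A B := fun j => T.obj (A j) (B j)
  hom f g := fun j => T.hom (f j) (g j)
  hom_id A B := funext fun j => T.hom_id (A j) (B j)
  hom_comp f f' g g' := funext fun j => T.hom_comp (f j) (f' j) (g j) (g' j)

/-- `A(j₁) ⊗ (A(j₂) ⊗ (⋯ ⊗ (A(jₖ) ⊗ I)))`. -/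
def tens (T : Product C) (I : C) (A : Collection C) : List ℕ → C
  | [] => I
  | j :: l => T.obj (A j) (tens T I A l)

/-- Functoriality of `tens` in the collection. -/
def tensMap (T : Product C) (I : C) {A B : Collection C} (f : A ⟶ B) :
    (l : List ℕ) → (tens T I A l ⟶ tens T I B l)
  | [] => 𝟙 I
  | j :: l => T.hom (f j) (tensMap T I f l)

theorem tensMap_id (T : Product C) (I : C) (A : Collection C) (l : List ℕ) :
    tensMap T I (𝟙 A) l = 𝟙 (tens T I A l) := by
  induction l with
  | nil => rfl
  | cons j l ih => exact (congrArg (T.hom (𝟙 (A j))) ih).trans (T.hom_id _ _)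

theorem tensMap_comp (T : Product C) (I : C) {A B D : Collection C} (f : A ⟶ B) (g : B ⟶ D)
    (l : List ℕ) : tensMap T I (f ≫ g) l = tensMap T I f l ≫ tensMap T I g l := by
  induction l with
  | nil => exact (Category.comp_id _).symm
  | cons j l ih => exact (congrArg (T.hom (f j ≫ g j)) ih).trans (T.hom_comp _ _ _ _)

section Composition

variable [HasCoproducts.{0} C]

/-- The composition product of collections: at `j` it is the coproduct over all `k ≥ 0` and
`j₁ + ⋯ + jₖ = j` of `A(k) ⊗_P (B(j₁) ⊗_Q ⋯ ⊗_Q B(jₖ))`. -/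
noncomputable def compObj (P Q : Product C) (I : C) (A B : Collection C) : Collection C :=
  fun j => ∐ fun l : {l : List ℕ // l.sum = j} => P.obj (A l.1.length) (tens Q I B l.1)

/-- The inclusion of the summand indexed by `l = [j₁, …, jₖ]`. -/
noncomputable def compι (P Q : Product C) (I : C) (A B : Collection C) {j : ℕ}
    (l : List ℕ) (h : l.sum = j) :
    P.obj (A l.length) (tens Q I B l) ⟶ compObj P Q I A B j :=
  Sigma.ι (fun l : {l : List ℕ // l.sum = j} => P.obj (A l.1.length) (tens Q I B l.1)) ⟨l, h⟩

/-- Functoriality of the composition product, at `j`. -/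
noncomputable def compHom (P Q : Product C) (I : C) {A A' B B' : Collection C}
    (f : A ⟶ A') (g : B ⟶ B') (j : ℕ) : compObj P Q I A B j ⟶ compObj P Q I A' B' j :=
  Limits.Sigma.map fun l : {l : List ℕ // l.sum = j} =>
    P.hom (f l.1.length) (tensMap Q I g l.1)

theorem compι_compHom (P Q : Product C) (I : C) {A A' B B' : Collection C}
    (f : A ⟶ A') (g : B ⟶ B') {j : ℕ} (l : List ℕ) (h : l.sum = j) :
    compι P Q I A B l h ≫ compHom P Q I f g j =
      P.hom (f l.length) (tensMap Q I g l) ≫ compι P Q I A' B' l h :=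
  Sigma.ι_map _ _

theorem compObj_hom_ext (P Q : Product C) (I : C) {A B : Collection C} {j : ℕ} {X : C}
    {f g : compObj P Q I A B j ⟶ X}
    (H : ∀ (l : List ℕ) (h : l.sum = j), compι P Q I A B l h ≫ f = compι P Q I A B l h ≫ g) :
    f = g :=
  Sigma.hom_ext _ _ fun l => H l.1 l.2

/-- The composition product `⊗^{PQ}` as a product on the category of collections. -/
noncomputable def compProduct (P Q : Product C) (I : C) : Product (Collection C) where
  obj A B := compObj P Q I A B
  hom f g := compHom P Q I f g
  hom_id A B := by
    funext j
    refine compObj_hom_ext P Q I fun l h => ?_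
    rw [compι_compHom, tensMap_id]
    exact (congrArg (· ≫ compι P Q I A B l h) (P.hom_id _ _)).trans
      ((Category.id_comp _).trans (Category.comp_id _).symm)
  hom_comp f f' g g' := by
    funext j
    refine compObj_hom_ext P Q I fun l h => ?_
    rw [compι_compHom, tensMap_comp]
    refine (congrArg (· ≫ compι P Q I _ _ l h) (P.hom_comp _ _ _ _)).trans ?_
    refine Eq.trans ?_ (Category.assoc _ _ _)
    rw [compι_compHom, Category.assoc, Category.assoc, compι_compHom]

/-- The unit `(∅, I, ∅, ∅, …)` of the composition product. -/
noncomputable def unitCollection (I : C) : Collection C :=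
  fun j => if j = 1 then I else ⊥_ C

/-- The unit `(I, I, I, …)` of the levelwise products. -/
def constCollection (I : C) : Collection C := fun _ => I

/-- The regrouping isomorphism, in the direction that splits a concatenation. -/
noncomputable def tensSplit {Q : Product C} {I : C} (M : LaxMonoidal Q I)
    (hM : ∀ X Y Z, IsIso (M.assoc X Y Z)) (A : Collection C) :
    (l l' : List ℕ) → (tens Q I A (l ++ l') ⟶ Q.obj (tens Q I A l) (tens Q I A l'))
  | [], l' => (M.leftUnitor (tens Q I A l')).inv
  | j :: l, l' =>
    Q.hom (𝟙 (A j)) (tensSplit M hM A l l') ≫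
      @inv _ _ _ _ (M.assoc (A j) (tens Q I A l) (tens Q I A l')) (hM _ _ _)

/-- For a list `L = [t₁, …, tₖ]` of lists, the map
`(⊗_Q B(|tₛ|)) ⊗_P (⊗_Q over the entries i of all tₛ of A(i)) ⟶ ⊗_Q (B ⊗^{PQ} A)(∑ tₛ)`
which regroups, applies the interchange from `P` to `Q`, and includes into the coproducts. -/
noncomputable def shuffle {P Q : Product C} {I : C} (e : Interchange P I Q I)
    (M : LaxMonoidal Q I) (hM : ∀ X Y Z, IsIso (M.assoc X Y Z)) (B A : Collection C) :
    (L : List (List ℕ)) →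
      (P.obj (tens Q I B (L.map List.length)) (tens Q I A L.flatten) ⟶
        tens Q I (compObj P Q I B A) (L.map List.sum))
  | [] => e.μ
  | t :: L =>
    P.hom (𝟙 _) (tensSplit M hM A t L.flatten) ≫
      e.η (B t.length) (tens Q I B (L.map List.length)) (tens Q I A t) (tens Q I A L.flatten) ≫
      Q.hom (compι P Q I B A t rfl) (shuffle e M hM B A L)

/-- The iterated interchange `⊗_Q (A(j) ⊗_R B(j)) ⟶ (⊗_Q A(j)) ⊗_R (⊗_Q B(j))`. -/
def tensInterchange {Q R : Product C} {I : C} (e : Interchange Q I R I) (A B : Collection C) :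
    (l : List ℕ) → (tens Q I ((levelProduct R).obj A B) l ⟶
      R.obj (tens Q I A l) (tens Q I B l))
  | [] => e.δ
  | j :: l => Q.hom (𝟙 _) (tensInterchange e A B l) ≫
      e.η (A j) (B j) (tens Q I A l) (tens Q I B l)

/-- The associator of the composition product is the one induced by the interchange from `P` to
`Q`: on the summand given by a list of lists `L = [t₁, …, tₖ]` it is the associator of `P`
followed by the shuffle. -/
def AssocInducedBy {P Q : Product C} {I : C} (MP : LaxMonoidal P I) (MQ : LaxMonoidal Q I)
    (hM : ∀ X Y Z, IsIso (MQ.assoc X Y Z)) (e : Interchange P I Q I)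
    (M : LaxMonoidal (compProduct P Q I) (unitCollection I)) : Prop :=
  ∀ (A B D : Collection C) (L : List (List ℕ)) (j : ℕ) (h : L.flatten.sum = j),
    P.hom (compι P Q I A B (L.map List.length) List.length_flatten.symm)
          (𝟙 (tens Q I D L.flatten)) ≫
        compι P Q I (compObj P Q I A B) D L.flatten h ≫ M.assoc A B D j =
      MP.assoc (A (L.map List.length).length) (tens Q I B (L.map List.length))
          (tens Q I D L.flatten) ≫
        P.hom (eqToHom (by simp)) (shuffle e MQ hM B D L) ≫
        compι P Q I A (compObj P Q I B D) (L.map List.sum) (List.sum_flatten.symm.trans h)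

/-- The interchange from the composition product to the levelwise product `R` is the one induced
by the interchanges from `Q` to `R` and from `P` to `R`. -/
def InterchangeInducedBy {P Q R : Product C} {I : C} (ePR : Interchange P I R I)
    (eQR : Interchange Q I R I)
    (ξ : Interchange (compProduct P Q I) (unitCollection I) (levelProduct R) (constCollection I)) :
    Prop :=
  ∀ (A B D E : Collection C) (l : List ℕ) (j : ℕ) (h : l.sum = j),
    compι P Q I ((levelProduct R).obj A B) ((levelProduct R).obj D E) l h ≫ ξ.η A B D E j =
      P.hom (𝟙 _) (tensInterchange eQR D E l) ≫
        ePR.η (A l.length) (B l.length) (tens Q I D l) (tens Q I E l) ≫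
        R.hom (compι P Q I A D l h) (compι P Q I B E l h)

end Composition

/-- The monoidal structure `N` of the levelwise product is the levelwise one. -/
def MonLevelwise {T : Product C} {I : C} (M : LaxMonoidal T I)
    (N : LaxMonoidal (levelProduct T) (constCollection I)) : Prop :=
  (∀ A B D j, N.assoc A B D j = M.assoc (A j) (B j) (D j)) ∧
  (∀ A j, (N.leftUnitor A).hom j = (M.leftUnitor (A j)).hom) ∧
  (∀ A j, (N.rightUnitor A).hom j = (M.rightUnitor (A j)).hom)

/-- The interchange `ξ` between two levelwise products is the levelwise one. -/
def InterchangeLevelwise {S T : Product C} {I : C} (e : Interchange S I T I)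
    (ξ : Interchange (levelProduct S) (constCollection I) (levelProduct T) (constCollection I)) :
    Prop :=
  (∀ A B D E j, ξ.η A B D E j = e.η (A j) (B j) (D j) (E j)) ∧
  (∀ j, ξ.δ j = e.δ) ∧ (∀ j, ξ.μ j = e.μ)

section Col

variable [HasCoproducts.{0} C]

/-- The products `⊗^{(m-1)m}, ⊗_{m+1}, …, ⊗_n` on collections in an `n`-fold monoidal category
(the indices `m - 2` and `m - 1` in `Fin n` stand for `⊗_{m-1}` and `⊗_m`). -/
noncomputable def IteratedMonoidal.colProducts {n : ℕ} (V : IteratedMonoidal n C) (m : ℕ)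
    (hm : 2 ≤ m) (hmn : m ≤ n) : Fin (n - m + 1) → Product (Collection C) :=
  Fin.cons (compProduct (V.T ⟨m - 2, by omega⟩) (V.T ⟨m - 1, by omega⟩) V.I)
    (fun i => levelProduct (V.T (V.upper m i)))

/-- The units of these products. -/
noncomputable def IteratedMonoidal.colUnits {n : ℕ} (V : IteratedMonoidal n C) (m : ℕ) :
    Fin (n - m + 1) → Collection C :=
  Fin.cons (unitCollection V.I) (fun _ => constCollection V.I)

end Col

end IterMon

/-!
Write `P = ⊗_{m-1}`, `Q = ⊗_m`, let `R` be one of the higher products, and let `∘` be the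
composition product `⊗^{PQ}`. All structure on collections is forced on the summands of the
coproducts that define `∘`, so every axiom is an equation between maps out of an iterated tensor
product in the given category.

*Associativity.* Since `P` preserves coproducts, `((A ∘ B) ∘ D)(j)` is a coproduct over lists of
lists `L` whose entries add up to `j` (`compComp_hom_ext`, `exists_compComp_desc`), because a list
together with a decomposition of its length is the same as a list of lists. Hence the associator
may be prescribed on each `L`, by the associator of `P` and `shuffle`. On triple composites the
summands are indexed by lists of lists of lists, and the pentagon for `∘` reduces to the pentagon
for `P` and the equality of the two ways of regrouping such a list (`shuffle_shuffle`). The latter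
goes by induction on the outermost list. The induction step is the internal associativity of the
interchange from `P` to `Q`, once it is known that the shuffle of a concatenation is the
interchange of the two shuffles (`shuffle_append`), which is external associativity.

*Units.* In the unit collection `(∅, I, ∅, …)` everything but degree one is initial, and products
with an initial object are initial. So only one summand of `(I ∘ A)(j)` and of `(A ∘ I)(j)` is not
initial, which gives the unit isomorphisms, and the triangle equations need to be checked only on
lists of lists of a very special shape (`shuffle_unit_left`, `shuffle_unit_right`,
`shuffle_singleton`).

*Interchanges.* The interchange from `∘` to `R` is, on each summand, the iterated interchange from
`Q` to `R` followed by the interchange from `P` to `R`. The axioms that involve no associator of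
`∘`, and the giant hexagon, follow from the corresponding properties of the iterated interchange,
which are proved by induction on lists. Internal associativity says that the iterated interchange
commutes with the shuffle (`shuffle_compInter`); here the giant hexagon for `P`, `Q` and `R` enters.

*Comparison maps.* The map `δ` from the unit of `∘` is an isomorphism `I ≅ I ⊗ I` in degree one and
an isomorphism of initial objects elsewhere. The map `μ` goes from a coproduct of objects isomorphic
to `I` over a nonempty index set to `I`. The unit axioms force the comparison map `I ⊔ I ⟶ I` of an
interchange from `⊔` to `R` to be the codiagonal (`coprod_comparison`). If it is an isomorphism,
then the two inclusions of `I` into `I ⊔ I` agree, so that any two maps from `I` to the same object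
agree, and therefore `μ` is an isomorphism as well (`isIso_compMu`).
-/

namespace IterMon

variable {C : Type u} [Category.{v} C]

/-! ### Products and units -/

section Basics

theorem Product.comp_hom (T : Product C) {X X' X'' Y Y' Y'' : C} (f : X ⟶ X') (f' : X' ⟶ X'')
    (g : Y ⟶ Y') (g' : Y' ⟶ Y'') :
    T.hom f g ≫ T.hom f' g' = T.hom (f ≫ f') (g ≫ g') :=
  (T.hom_comp f f' g g').symm

theorem Product.comp_hom_assoc (T : Product C) {X X' X'' Y Y' Y'' Z : C} (f : X ⟶ X')
    (f' : X' ⟶ X'') (g : Y ⟶ Y') (g' : Y' ⟶ Y'') (k : T.obj X'' Y'' ⟶ Z) :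
    T.hom f g ≫ T.hom f' g' ≫ k = T.hom (f ≫ f') (g ≫ g') ≫ k := by
  rw [← Category.assoc, T.comp_hom]

instance Product.isIso_hom (T : Product C) {X X' Y Y' : C} (f : X ⟶ X') (g : Y ⟶ Y') [IsIso f]
    [IsIso g] : IsIso (T.hom f g) :=
  ⟨T.hom (inv f) (inv g), by simp [T.comp_hom, T.hom_id], by simp [T.comp_hom, T.hom_id]⟩

theorem LaxMonoidal.assoc_naturality_assoc {T : Product C} {U : C} (M : LaxMonoidal T U)
    {X X' Y Y' Z Z' W : C} (f : X ⟶ X') (g : Y ⟶ Y') (h : Z ⟶ Z')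
    (k : T.obj X' (T.obj Y' Z') ⟶ W) :
    T.hom (T.hom f g) h ≫ M.assoc X' Y' Z' ≫ k =
      M.assoc X Y Z ≫ T.hom f (T.hom g h) ≫ k := by
  rw [← Category.assoc, M.assoc_naturality, Category.assoc]

theorem Interchange.η_naturality_assoc {S T : Product C} {U U' : C} (e : Interchange S U T U')
    {X X' Y Y' Z Z' W W' V : C} (f : X ⟶ X') (g : Y ⟶ Y') (h : Z ⟶ Z') (k : W ⟶ W')
    (t : T.obj (S.obj X' Z') (S.obj Y' W') ⟶ V) :
    S.hom (T.hom f g) (T.hom h k) ≫ e.η X' Y' Z' W' ≫ t =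
      e.η X Y Z W ≫ T.hom (S.hom f h) (S.hom g k) ≫ t := by
  rw [← Category.assoc, e.η_naturality, Category.assoc]

/-- Since `U` is a unit, the functor `- ⊗ U` is faithful. -/
theorem LaxMonoidal.hom_id_injective {T : Product C} {U : C} (M : LaxMonoidal T U) {X Y : C}
    {f g : X ⟶ Y} (h : T.hom f (𝟙 U) = T.hom g (𝟙 U)) : f = g := by
  rw [← cancel_epi (M.rightUnitor X).hom, ← M.rightUnitor_naturality, h, M.rightUnitor_naturality]

/-- Kelly's argument: the two unit isomorphisms of the unit object agree. It does not need the
associator to be invertible. -/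
theorem LaxMonoidal.rightUnitor_unit {T : Product C} {U : C} (M : LaxMonoidal T U) :
    (M.rightUnitor U).hom = (M.leftUnitor U).hom := by
  apply M.hom_id_injective
  have h : (M.leftUnitor (T.obj U U)).hom = T.hom (𝟙 U) (M.leftUnitor U).hom := by
    rw [← cancel_mono (M.leftUnitor U).hom, M.leftUnitor_naturality]
  rw [← M.triangle, ← M.triangle_left, h]

theorem LaxMonoidal.leftUnitor_inv_naturality {T : Product C} {U : C} (M : LaxMonoidal T U)
    {X X' : C} (f : X ⟶ X') :
    (M.leftUnitor X).inv ≫ T.hom (𝟙 U) f = f ≫ (M.leftUnitor X').inv := by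
  rw [Iso.inv_comp_eq, ← Category.assoc, ← M.leftUnitor_naturality]; simp

/-- The triangle equation for a unit in the left position, up to naturality. -/
theorem LaxMonoidal.assoc_hom_leftUnitor {T : Product C} {U : C} (M : LaxMonoidal T U)
    {X A A' B B' Y : C} (u : X ⟶ U) (a : A ⟶ A') (b : B ⟶ B') (f : T.obj A' B' ⟶ Y) :
    M.assoc X A B ≫ T.hom u (T.hom a b ≫ f) ≫ (M.leftUnitor Y).hom =
      T.hom (T.hom u a ≫ (M.leftUnitor A').hom) b ≫ f := by
  have h : T.hom u (T.hom a b ≫ f) = T.hom u (T.hom a b) ≫ T.hom (𝟙 U) f := by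
    rw [T.comp_hom, Category.comp_id]
  rw [h, Category.assoc, M.leftUnitor_naturality, ← M.assoc_naturality_assoc,
    reassoc_of% (M.triangle_left A' B'), T.comp_hom_assoc, Category.comp_id]

/-- An interchange between products with a common unit `I` which satisfies the coherence axioms
and whose unit comparisons are the canonical identifications `I ≅ I ⊗ I` and `I ⊗ I ≅ I`. -/
structure Interchange.Normal {S T : Product C} {I : C} (e : Interchange S I T I)
    (M : LaxMonoidal S I) (N : LaxMonoidal T I) : Prop extends e.Coherent M N where
  δ_eq : e.δ = (N.leftUnitor I).inv
  μ_eq : e.μ = (M.leftUnitor I).hom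

/-- The compatibility of an interchange with associators, which is internal associativity up to
naturality. -/
theorem Interchange.Coherent.interchange_assoc {P Q : Product C} {U U' : C}
    {e : Interchange P U Q U'} {MP : LaxMonoidal P U} {M : LaxMonoidal Q U'} (he : e.Coherent MP M)
    {X₁ X₂ X₁' X₂' Y Y₁ Y₂ Z Z₁ Z₁' Z₂ Z₂' A₁ A₂ B₁ B₂ W₁ W₂ : C}
    (b : Y ⟶ Q.obj Y₁ Y₂) (c : Z ⟶ Q.obj Z₁ Z₂)
    (f₁ : P.obj X₁ Y₁ ⟶ A₁) (f₂ : P.obj X₂ Y₂ ⟶ A₂) (p₁ : Z₁ ⟶ Z₁') (p₂ : Z₂ ⟶ Z₂')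
    (g₁ : P.obj A₁ Z₁' ⟶ W₁) (g₂ : P.obj A₂ Z₂' ⟶ W₂)
    (q₁ : X₁ ⟶ X₁') (q₂ : X₂ ⟶ X₂') (k₁ : P.obj Y₁ Z₁ ⟶ B₁) (k₂ : P.obj Y₂ Z₂ ⟶ B₂)
    (r₁ : P.obj X₁' B₁ ⟶ W₁) (r₂ : P.obj X₂' B₂ ⟶ W₂)
    (h₁ : P.hom f₁ p₁ ≫ g₁ = MP.assoc _ _ _ ≫ P.hom q₁ k₁ ≫ r₁)
    (h₂ : P.hom f₂ p₂ ≫ g₂ = MP.assoc _ _ _ ≫ P.hom q₂ k₂ ≫ r₂) :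
    P.hom (P.hom (𝟙 _) b ≫ e.η _ _ _ _ ≫ Q.hom f₁ f₂) (c ≫ Q.hom p₁ p₂) ≫ e.η _ _ _ _ ≫
        Q.hom g₁ g₂ =
      MP.assoc _ _ _ ≫ P.hom (Q.hom q₁ q₂) (P.hom b c ≫ e.η _ _ _ _ ≫ Q.hom k₁ k₂) ≫
        e.η _ _ _ _ ≫ Q.hom r₁ r₂ := by
  have e₁ : P.hom (P.hom (𝟙 _) b ≫ e.η X₁ X₂ _ _ ≫ Q.hom f₁ f₂) (c ≫ Q.hom p₁ p₂) =
      P.hom (P.hom (𝟙 _) b) c ≫ P.hom (e.η _ _ _ _) (𝟙 _) ≫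
        P.hom (Q.hom f₁ f₂) (Q.hom p₁ p₂) := by
    rw [P.comp_hom, P.comp_hom, Category.id_comp]
  have e₂ : P.hom (Q.hom q₁ q₂) (P.hom b c ≫ e.η _ _ _ _ ≫ Q.hom k₁ k₂) =
      P.hom (𝟙 _) (P.hom b c) ≫ P.hom (𝟙 _) (e.η _ _ _ _) ≫
        P.hom (Q.hom q₁ q₂) (Q.hom k₁ k₂) := by
    rw [P.comp_hom, P.comp_hom, Category.id_comp, Category.id_comp]
  have e₃ := he.internal_assoc X₁ X₂ Y₁ Y₂ Z₁ Z₂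
  rw [e₁, e₂]
  simp only [Category.assoc]
  rw [e.η_naturality_assoc, e.η_naturality_assoc, Q.comp_hom, Q.comp_hom, h₁, h₂, Q.hom_comp,
    reassoc_of% e₃, MP.assoc_naturality_assoc]

/-- The compatibility of an interchange with splittings of tensor products into three factors,
which is external associativity up to naturality. -/
theorem Interchange.Normal.interchange_split {P Q : Product C} {I : C}
    {e : Interchange P I Q I} {MP : LaxMonoidal P I} {M : LaxMonoidal Q I} (he : e.Normal MP M)
    {X X₀ X₁ X₂ Y Y₀ Y₁ Y₂ Y₀₁ Y₁₂ Z₀ Z₁ Z₂ : C} [IsIso (M.assoc X₀ X₁ X₂)]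
    (f : P.obj X₀ Y₀ ⟶ Z₀) (g : P.obj X₁ Y₁ ⟶ Z₁) (h : P.obj X₂ Y₂ ⟶ Z₂)
    (a : X ⟶ Q.obj X₁ X₂) (b : Y₁₂ ⟶ Q.obj Y₁ Y₂) (c : Y ⟶ Q.obj Y₀ Y₁₂)
    (b' : Y₀₁ ⟶ Q.obj Y₀ Y₁) (c' : Y ⟶ Q.obj Y₀₁ Y₂)
    (hs : c' ≫ Q.hom b' (𝟙 _) ≫ M.assoc _ _ _ = c ≫ Q.hom (𝟙 _) b) :
    P.hom (𝟙 _) c ≫ e.η X₀ X Y₀ Y₁₂ ≫ Q.hom f (P.hom a b ≫ e.η _ _ _ _ ≫ Q.hom g h) =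
      P.hom (Q.hom (𝟙 _) a ≫ inv (M.assoc X₀ X₁ X₂)) c' ≫ e.η _ _ _ _ ≫
        Q.hom (P.hom (𝟙 _) b' ≫ e.η _ _ _ _ ≫ Q.hom f g) h ≫ M.assoc _ _ _ := by
  have h1 : Q.hom f (P.hom a b ≫ e.η _ _ _ _ ≫ Q.hom g h) =
      Q.hom (P.hom (𝟙 _) (𝟙 _)) (P.hom a b) ≫ Q.hom (𝟙 _) (e.η _ _ _ _) ≫
        Q.hom f (Q.hom g h) := by
    rw [Q.comp_hom, Q.comp_hom, P.hom_id, Category.id_comp, Category.id_comp]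
  have h2 : Q.hom (P.hom (𝟙 _) b' ≫ e.η X₀ X₁ _ _ ≫ Q.hom f g) h =
      Q.hom (P.hom (Q.hom (𝟙 _) (𝟙 _)) b') (P.hom (𝟙 _) (𝟙 _)) ≫ Q.hom (e.η _ _ _ _) (𝟙 _) ≫
        Q.hom (Q.hom f g) h := by
    rw [Q.comp_hom, Q.comp_hom, P.hom_id, Q.hom_id, Category.id_comp, Category.id_comp]
  have h3 := he.external_assoc X₀ X₁ X₂ Y₀ Y₁ Y₂
  rw [h1, h2, ← e.η_naturality_assoc, P.comp_hom_assoc, Category.id_comp, ← hs]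
  simp only [Category.assoc]
  rw [← e.η_naturality_assoc, M.assoc_naturality, P.comp_hom_assoc, reassoc_of% h3,
    P.comp_hom_assoc, Q.hom_id, Q.hom_id]
  simp

/-- The internal unit condition with `δ` moved to the other side, where it becomes the inverse of a
unit isomorphism. -/
theorem Interchange.Normal.η_unit_left {S T : Product C} {I : C} {e : Interchange S I T I}
    {M : LaxMonoidal S I} {N : LaxMonoidal T I} (he : e.Normal M N) (A B : C) :
    e.η I I A B ≫ T.hom (M.leftUnitor A).hom (M.leftUnitor B).hom =
      S.hom (N.leftUnitor I).hom (𝟙 _) ≫ (M.leftUnitor _).hom := by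
  rw [← he.internal_unit_left, he.δ_eq, S.comp_hom_assoc, Iso.hom_inv_id, Category.comp_id,
    S.hom_id, Category.id_comp]

theorem Interchange.Normal.η_unit_right {S T : Product C} {I : C} {e : Interchange S I T I}
    {M : LaxMonoidal S I} {N : LaxMonoidal T I} (he : e.Normal M N) (A B : C) :
    e.η A B I I ≫ T.hom (M.rightUnitor A).hom (M.rightUnitor B).hom =
      S.hom (𝟙 _) (N.leftUnitor I).hom ≫ (M.rightUnitor _).hom := by
  rw [← he.internal_unit_right, he.δ_eq, S.comp_hom_assoc, Iso.hom_inv_id, Category.comp_id,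
    S.hom_id, Category.id_comp]

/-- All functors `A ⊗ -` and `- ⊗ A` preserve coproducts indexed by sets. -/
def Product.PreservesCoproducts (T : Product C) : Prop :=
  ∀ (A : C) (J : Type), PreservesColimitsOfShape (Discrete J) (T.left A) ∧
    PreservesColimitsOfShape (Discrete J) (T.right A)

theorem Product.PreservesCoproducts.isInitial_left {T : Product C} (hT : T.PreservesCoproducts)
    {X : C} (hX : Nonempty (IsInitial X)) (Y : C) : Nonempty (IsInitial (T.obj X Y)) := by
  have := (hT Y PEmpty).2
  exact ⟨IsInitial.isInitialObj (T.right Y) X hX.some⟩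

theorem Product.PreservesCoproducts.isInitial_right {T : Product C} (hT : T.PreservesCoproducts)
    (X : C) {Y : C} (hY : Nonempty (IsInitial Y)) : Nonempty (IsInitial (T.obj X Y)) := by
  have := (hT X PEmpty).1
  exact ⟨IsInitial.isInitialObj (T.left X) Y hY.some⟩

theorem hom_ext_of_isInitial {X Y : C} (hX : Nonempty (IsInitial X)) (f g : X ⟶ Y) : f = g :=
  hX.some.hom_ext f g

end Basics

/-! ### Iterated tensor products indexed by lists -/

section Tens

/-- Transport of `A j` along an equality of indices. -/
def castHom (A : Collection C) {j j' : ℕ} (h : j = j') : A j ⟶ A j' := eqToHom (congrArg A h)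

@[simp]
theorem castHom_rfl (A : Collection C) {j : ℕ} (h : j = j) : castHom A h = 𝟙 (A j) := rfl

theorem castHom_trans (A : Collection C) {j j' j'' : ℕ} (h : j = j') (h' : j' = j'') :
    castHom A h ≫ castHom A h' = castHom A (h.trans h') := by
  subst h h'; simp

theorem castHom_naturality {A B : Collection C} (f : A ⟶ B) {j j' : ℕ} (h : j = j') :
    castHom A h ≫ f j' = f j ≫ castHom B h := by
  subst h; simp

theorem hom_castHom (R : Product C) (A B : Collection C) {i j : ℕ} (h : i = j) :
    R.hom (castHom A h) (castHom B h) = castHom (fun j => R.obj (A j) (B j)) h := by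
  subst h
  exact R.hom_id _ _

/-- Transport of an iterated tensor product along an equality of lists. -/
def tensCast (Q : Product C) (I : C) (A : Collection C) {l l' : List ℕ} (h : l = l') :
    tens Q I A l ⟶ tens Q I A l' :=
  eqToHom (congrArg (tens Q I A) h)

@[simp]
theorem tensCast_rfl (Q : Product C) (I : C) (A : Collection C) {l : List ℕ} (h : l = l) :
    tensCast Q I A h = 𝟙 _ := rfl

theorem tensCast_cons (Q : Product C) (I : C) (A : Collection C) {j j' : ℕ} {l l' : List ℕ}
    (hj : j = j') (hl : l = l') (h : j :: l = j' :: l') :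
    tensCast Q I A h = Q.hom (castHom A hj) (tensCast Q I A hl) := by
  subst hj hl
  exact (Q.hom_id _ _).symm

theorem tensCast_trans (Q : Product C) (I : C) (A : Collection C) {l l' l'' : List ℕ}
    (h : l = l') (h' : l' = l'') :
    tensCast Q I A h ≫ tensCast Q I A h' = tensCast Q I A (h.trans h') := by
  subst h h'; simp

variable {Q : Product C} {I : C} (M : LaxMonoidal Q I) (hM : ∀ X Y Z, IsIso (M.assoc X Y Z))

theorem tensSplit_cons_assoc (A : Collection C) (j : ℕ) (l l' : List ℕ) :
    tensSplit M hM A (j :: l) l' ≫ M.assoc (A j) (tens Q I A l) (tens Q I A l') =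
      Q.hom (𝟙 (A j)) (tensSplit M hM A l l') := by
  simp only [tensSplit]
  erw [Category.assoc, IsIso.inv_hom_id, Category.comp_id]

theorem tensSplit_cast (A : Collection C) {l₁ l₂ l₁' l₂' : List ℕ} (h : l₁ = l₂) (h' : l₁' = l₂')
    (h'' : l₁ ++ l₁' = l₂ ++ l₂') :
    tensCast Q I A h'' ≫ tensSplit M hM A l₂ l₂' =
      tensSplit M hM A l₁ l₁' ≫ Q.hom (tensCast Q I A h) (tensCast Q I A h') := by
  subst h h'; simp [Q.hom_id]

theorem tensSplit_naturality {A B : Collection C} (f : A ⟶ B) (l l' : List ℕ) :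
    tensMap Q I f (l ++ l') ≫ tensSplit M hM B l l' =
      tensSplit M hM A l l' ≫ Q.hom (tensMap Q I f l) (tensMap Q I f l') := by
  induction l with
  | nil => exact (M.leftUnitor_inv_naturality _).symm
  | cons j l ih =>
    dsimp only [tens, List.cons_append, tensMap, tensSplit]
    rw [← cancel_mono (M.assoc _ _ _)]
    simp only [Category.assoc, IsIso.inv_hom_id, Category.comp_id, M.assoc_naturality,
      IsIso.inv_hom_id_assoc, Q.comp_hom, ih, Category.id_comp]

/-- Splitting a concatenation of three lists does not depend on the order of the splittings. -/
theorem tensSplit_append (A : Collection C) (l l' l'' : List ℕ)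
    (h : l ++ (l' ++ l'') = (l ++ l') ++ l'') :
    tensCast Q I A h ≫ tensSplit M hM A (l ++ l') l'' ≫
        Q.hom (tensSplit M hM A l l') (𝟙 _) ≫ M.assoc _ _ _ =
      tensSplit M hM A l (l' ++ l'') ≫ Q.hom (𝟙 _) (tensSplit M hM A l' l'') := by
  induction l with
  | nil =>
    dsimp only [tens, List.nil_append, tensSplit]
    rw [tensCast_rfl, M.leftUnitor_inv_naturality, Category.id_comp,
      ← cancel_mono (M.leftUnitor (Q.obj _ _)).hom]
    simp only [Category.assoc, Iso.inv_hom_id, M.triangle_left, Q.comp_hom, Q.hom_id,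
      Category.comp_id]
  | cons j l ih =>
    have hl : l ++ (l' ++ l'') = (l ++ l') ++ l'' := (List.append_assoc _ _ _).symm
    dsimp only [tens, List.cons_append, tensSplit]
    rw [tensCast_cons Q I A rfl hl, castHom_rfl]
    have := hM (A j) (tens Q I A l) (Q.obj (tens Q I A l') (tens Q I A l''))
    rw [← cancel_mono (M.assoc (A j) (tens Q I A l) (Q.obj (tens Q I A l') (tens Q I A l'')))]
    have e1 : Q.hom (Q.hom (𝟙 (A j)) (tensSplit M hM A l l') ≫ inv (M.assoc _ _ _))
        (𝟙 (tens Q I A l'')) ≫ M.assoc _ _ _ ≫ M.assoc _ _ _ =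
      M.assoc _ _ _ ≫ Q.hom (𝟙 (A j)) (Q.hom (tensSplit M hM A l l') (𝟙 _) ≫ M.assoc _ _ _) := by
      rw [← M.pentagon, Q.comp_hom_assoc, Category.assoc, IsIso.inv_hom_id, Category.comp_id,
        Category.comp_id, M.assoc_naturality_assoc, Q.comp_hom, Category.comp_id]
    simp only [Category.assoc]
    rw [e1, IsIso.inv_hom_id_assoc, Q.comp_hom_assoc, Q.comp_hom, Category.comp_id,
      Category.comp_id, Category.assoc, ih, ← Q.hom_id, M.assoc_naturality,
      IsIso.inv_hom_id_assoc, Q.comp_hom, Category.comp_id]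

theorem tensSplit_nil_right (A : Collection C) (l : List ℕ) :
    tensSplit M hM A l [] ≫ (M.rightUnitor (tens Q I A l)).hom =
      tensCast Q I A (List.append_nil l) := by
  induction l with
  | nil =>
    dsimp only [tensSplit, tens, List.nil_append]
    rw [M.rightUnitor_unit, Iso.inv_hom_id]
    rfl
  | cons j l ih =>
    rw [tensCast_cons Q I A rfl (List.append_nil l), ← ih, castHom_rfl]
    refine (congrArg (tensSplit M hM A (j :: l) [] ≫ ·)
      (M.triangle_right (A j) (tens Q I A l)).symm).trans ?_
    refine ((Category.assoc _ _ _).symm.trans (congrArg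
      (· ≫ Q.hom (𝟙 (A j)) (M.rightUnitor (tens Q I A l)).hom)
      (tensSplit_cons_assoc M hM A j l []))).trans ?_
    exact (Q.comp_hom _ _ _ _).trans (by rw [Category.comp_id])

end Tens

/-! ### The shuffle -/

section Shuffle

variable [HasCoproducts.{0} C] {P Q : Product C} {I : C} (e : Interchange P I Q I)
  (M : LaxMonoidal Q I) (hM : ∀ X Y Z, IsIso (M.assoc X Y Z))

theorem compι_castHom (P Q : Product C) (I : C) (A B : Collection C) {j j' : ℕ} (l : List ℕ)
    (h : l.sum = j) (hj : j = j') :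
    compι P Q I A B l h ≫ castHom (compObj P Q I A B) hj = compι P Q I A B l (h.trans hj) := by
  subst hj; simp

theorem cast_compι (P Q : Product C) (I : C) (A B : Collection C) {j : ℕ} {l l' : List ℕ}
    (hl : l = l') (hlen : l.length = l'.length) (h : l'.sum = j) :
    P.hom (castHom A hlen) (tensCast Q I B hl) ≫ compι P Q I A B l' h =
      compι P Q I A B l (hl ▸ h) := by
  subst hl; simp [P.hom_id]

theorem shuffle_naturality {B B' A A' : Collection C} (f : B ⟶ B') (g : A ⟶ A')
    (L : List (List ℕ)) :
    P.hom (tensMap Q I f (L.map List.length)) (tensMap Q I g L.flatten) ≫ shuffle e M hM B' A' L =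
      shuffle e M hM B A L ≫ tensMap Q I ((compProduct P Q I).hom f g) (L.map List.sum) := by
  induction L with
  | nil =>
    dsimp only [tens, shuffle, tensMap, List.map, List.flatten_nil]
    rw [P.hom_id, Category.id_comp, Category.comp_id]
  | cons t L ih =>
    dsimp only [tens, shuffle, tensMap, List.map, List.flatten_cons, compProduct] at ih ⊢
    simp only [Category.assoc, Q.comp_hom]
    rw [compι_compHom, P.comp_hom_assoc, tensSplit_naturality, Category.comp_id, ← ih,
      Q.hom_comp, ← e.η_naturality_assoc, P.comp_hom_assoc, Category.id_comp]

/-- The shuffle of a concatenation is the interchange of the shuffles. -/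
theorem shuffle_append {MP : LaxMonoidal P I} (he : e.Normal MP M) (D E : Collection C)
    (T T' : List (List ℕ)) :
    shuffle e M hM D E (T ++ T') ≫ tensCast Q I (compObj P Q I D E) List.map_append ≫
        tensSplit M hM (compObj P Q I D E) (T.map List.sum) (T'.map List.sum) =
      P.hom (tensCast Q I D List.map_append ≫
          tensSplit M hM D (T.map List.length) (T'.map List.length))
        (tensCast Q I E List.flatten_append ≫ tensSplit M hM E T.flatten T'.flatten) ≫
        e.η _ _ _ _ ≫ Q.hom (shuffle e M hM D E T) (shuffle e M hM D E T') := by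
  induction T with
  | nil =>
    dsimp only [tens, shuffle, List.map, List.flatten_nil, List.nil_append, tensSplit]
    simp only [tensCast_rfl, Category.id_comp]
    have h := he.external_unit_left (tens Q I D (T'.map List.length)) (tens Q I E T'.flatten)
    rw [← cancel_mono (M.leftUnitor _).hom]
    simp only [Category.assoc, Iso.inv_hom_id, Category.comp_id]
    have h' : Q.hom e.μ (shuffle e M hM D E T') =
        Q.hom e.μ (𝟙 _) ≫ Q.hom (𝟙 I) (shuffle e M hM D E T') := by
      rw [Q.comp_hom, Category.id_comp, Category.comp_id]
    rw [h', Category.assoc, M.leftUnitor_naturality, reassoc_of% h, P.comp_hom_assoc]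
    simp [P.hom_id]
  | cons t T ih =>
    have h1 : (T ++ T').map List.sum = T.map List.sum ++ T'.map List.sum := List.map_append
    have h2 : (T ++ T').map List.length = T.map List.length ++ T'.map List.length :=
      List.map_append
    have h3 : (T ++ T').flatten = T.flatten ++ T'.flatten := List.flatten_append
    dsimp only [tens, shuffle, List.map, List.flatten_cons, List.cons_append, tensSplit]
    rw [tensCast_cons Q I _ rfl h1, tensCast_cons Q I _ rfl h2, castHom_rfl, castHom_rfl]
    have := hM (compObj P Q I D E t.sum) (tens Q I (compObj P Q I D E) (T.map List.sum))
      (tens Q I (compObj P Q I D E) (T'.map List.sum))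
    rw [← cancel_mono (M.assoc (compObj P Q I D E t.sum)
      (tens Q I (compObj P Q I D E) (T.map List.sum))
      (tens Q I (compObj P Q I D E) (T'.map List.sum)))]
    simp only [Category.assoc, Q.comp_hom_assoc, Category.comp_id, IsIso.inv_hom_id]
    rw [ih]
    have := hM (D t.length) (tens Q I D (T.map List.length)) (tens Q I D (T'.map List.length))
    refine he.interchange_split _ _ _ _ _ _ _ _ ?_
    have h4 := tensSplit_append M hM E t T.flatten T'.flatten (List.append_assoc _ _ _).symm
    have h5 := tensSplit_cast M hM E (rfl : t = t) h3 (congrArg (t ++ ·) h3)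
    rw [← tensCast_trans Q I E (congrArg (t ++ ·) h3) (List.append_assoc _ _ _).symm,
      Category.assoc, Category.assoc, h4, reassoc_of% h5, Q.comp_hom]
    simp

end Shuffle

/-! ### The associator of the composition product -/

section Assoc

variable [HasCoproducts.{0} C] {P Q : Product C} {I : C}

/-- A functor which preserves coproducts turns the inclusions into a coproduct into a colimit
cofan. -/
theorem exists_unique_map_sigma_desc {J : Type} (F : C ⥤ C)
    [PreservesColimitsOfShape (Discrete J) F] (X : J → C) {Y : C}
    (φ : ∀ i, F.obj (X i) ⟶ Y) :
    ∃! f : F.obj (∐ X) ⟶ Y, ∀ i, F.map (Sigma.ι X i) ≫ f = φ i := by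
  have hc := isColimitCofanMkObjOfIsColimit F X (Sigma.ι X) (coproductIsCoproduct X)
  refine ⟨Cofan.IsColimit.desc hc φ, fun i => Cofan.IsColimit.fac hc φ i, fun g hg => ?_⟩
  exact Cofan.IsColimit.hom_ext hc _ _ fun i =>
    (hg i).trans (Cofan.IsColimit.fac hc φ i).symm

theorem exists_compObj_right_desc (hP : P.PreservesCoproducts) {A B : Collection C} {k : ℕ}
    {X Y : C}
    (φ : ∀ l : List ℕ, l.sum = k → (P.obj (P.obj (A l.length) (tens Q I B l)) X ⟶ Y)) :
    ∃! f : P.obj (compObj P Q I A B k) X ⟶ Y,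
      ∀ l h, P.hom (compι P Q I A B l h) (𝟙 X) ≫ f = φ l h := by
  have := (hP X {l : List ℕ // l.sum = k}).2
  obtain ⟨f, hf, hu⟩ := exists_unique_map_sigma_desc (P.right X)
    (fun l : {l : List ℕ // l.sum = k} => P.obj (A l.1.length) (tens Q I B l.1))
    (fun l => φ l.1 l.2)
  exact ⟨f, fun l h => hf ⟨l, h⟩, fun g hg => hu g fun l => hg l.1 l.2⟩

theorem compObj_right_hom_ext (hP : P.PreservesCoproducts) {A B : Collection C} {k : ℕ}
    {X Y : C} {f g : P.obj (compObj P Q I A B k) X ⟶ Y}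
    (H : ∀ (l : List ℕ) (h : l.sum = k),
      P.hom (compι P Q I A B l h) (𝟙 X) ≫ f = P.hom (compι P Q I A B l h) (𝟙 X) ≫ g) : f = g :=
  (exists_compObj_right_desc hP (fun l h => P.hom (compι P Q I A B l h) (𝟙 X) ≫ g)).unique
    (fun l h => H l h) (fun _ _ => rfl)

/-- A list of length `∑ l'` is the concatenation of a unique list of lists with lengths `l'`. -/
theorem exists_flatten_eq {α : Type*} (l' : List ℕ) (l : List α) (h : l'.sum = l.length) :
    ∃ L : List (List α), L.map List.length = l' ∧ L.flatten = l := by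
  induction l' generalizing l with
  | nil => exact ⟨[], rfl, (List.eq_nil_of_length_eq_zero h.symm).symm⟩
  | cons k l' ih =>
    rw [List.sum_cons] at h
    obtain ⟨L, hL, hL'⟩ := ih (l.drop k) (by rw [List.length_drop]; omega)
    exact ⟨l.take k :: L, by simp [hL]; omega, by simp [hL']⟩

theorem eq_of_flatten_eq {α : Type*} {L L' : List (List α)}
    (h : L.map List.length = L'.map List.length) (h' : L.flatten = L'.flatten) : L = L' :=
  List.eq_iff_flatten_eq.2 ⟨h', h⟩

/-- The inclusion into `((A ∘ B) ∘ D)(j)` of the summand given by a list of lists. -/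
noncomputable def compCompι (P Q : Product C) (I : C) (A B D : Collection C) {j : ℕ}
    (L : List (List ℕ)) (h : L.flatten.sum = j) :
    P.obj (P.obj (A (L.map List.length).length) (tens Q I B (L.map List.length)))
      (tens Q I D L.flatten) ⟶ compObj P Q I (compObj P Q I A B) D j :=
  P.hom (compι P Q I A B (L.map List.length) List.length_flatten.symm)
      (𝟙 (tens Q I D L.flatten)) ≫ compι P Q I (compObj P Q I A B) D L.flatten h

theorem compComp_hom_ext (hP : P.PreservesCoproducts) {A B D : Collection C} {j : ℕ} {Y : C}
    {f g : compObj P Q I (compObj P Q I A B) D j ⟶ Y}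
    (H : ∀ (L : List (List ℕ)) (h : L.flatten.sum = j),
      compCompι P Q I A B D L h ≫ f = compCompι P Q I A B D L h ≫ g) : f = g := by
  refine compObj_hom_ext P Q I fun l h => compObj_right_hom_ext hP fun l' h' => ?_
  obtain ⟨L, rfl, rfl⟩ := exists_flatten_eq l' l h'
  simpa only [compCompι, Category.assoc] using H L h

theorem compObj_right_right_hom_ext (hP : P.PreservesCoproducts) {A B : Collection C} {k : ℕ}
    {X X' Y : C} {f g : P.obj (P.obj (compObj P Q I A B k) X) X' ⟶ Y}
    (H : ∀ (l : List ℕ) (h : l.sum = k),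
      P.hom (P.hom (compι P Q I A B l h) (𝟙 X)) (𝟙 X') ≫ f =
        P.hom (P.hom (compι P Q I A B l h) (𝟙 X)) (𝟙 X') ≫ g) : f = g := by
  have := (hP X {l : List ℕ // l.sum = k}).2
  have := (hP X' {l : List ℕ // l.sum = k}).2
  exact (exists_unique_map_sigma_desc (P.right X ⋙ P.right X')
    (fun l : {l : List ℕ // l.sum = k} => P.obj (A l.1.length) (tens Q I B l.1))
    (fun l => P.hom (P.hom (compι P Q I A B l.1 l.2) (𝟙 X)) (𝟙 X') ≫ g)).unique
    (fun l => H l.1 l.2) (fun _ => rfl)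

/-- Maps out of `((A ∘ B) ∘ D)(j)` may be prescribed on each list of lists. -/
theorem exists_compComp_desc (hP : P.PreservesCoproducts) {A B D : Collection C} {j : ℕ} {Y : C}
    (φ : ∀ L : List (List ℕ), L.flatten.sum = j →
      (P.obj (P.obj (A (L.map List.length).length) (tens Q I B (L.map List.length)))
        (tens Q I D L.flatten) ⟶ Y)) :
    ∃ f : compObj P Q I (compObj P Q I A B) D j ⟶ Y,
      ∀ L h, compCompι P Q I A B D L h ≫ f = φ L h := by
  choose s hs hs' using exists_flatten_eq (α := ℕ)
  -- The summand is given as a pair `(l', l)`, and `L` is recovered from it. The statement quantifies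
  -- over all `L` giving this pair, so that no transport along a chosen `L` is needed later.
  have H : ∀ (l' l : List ℕ) (h : l'.sum = l.length) (hl : l.sum = j),
      ∃ ψ : P.obj (P.obj (A l'.length) (tens Q I B l')) (tens Q I D l) ⟶ Y,
        ∀ (L : List (List ℕ)) (h₁ : L.map List.length = l') (h₂ : L.flatten = l),
          eqToHom (by rw [h₁, h₂]) ≫ ψ = φ L (h₂ ▸ hl) := by
    intro l' l h hl
    obtain ⟨L, rfl, rfl⟩ := exists_flatten_eq l' l h
    refine ⟨φ L hl, fun L' h₁ h₂ => ?_⟩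
    obtain rfl := eq_of_flatten_eq h₁ h₂
    simp
  choose ψ hψ using H
  choose f hf using fun (l : List ℕ) (hl : l.sum = j) =>
    (exists_compObj_right_desc (Q := Q) (I := I) (A := A) (B := B) hP
      fun l' h => ψ l' l h hl).exists
  refine ⟨Sigma.desc fun l => f l.1 l.2, fun L h => ?_⟩
  have h1 := hψ (L.map List.length) L.flatten List.length_flatten.symm h L rfl rfl
  rw [eqToHom_refl, Category.id_comp] at h1
  rw [← h1, ← hf]
  refine (Category.assoc _ _ _).trans (congrArg (_ ≫ ·) ?_)
  exact Sigma.ι_desc (fun l : {l : List ℕ // l.sum = j} => f l.1 l.2) ⟨L.flatten, h⟩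

/-- Maps out of a triple composite are determined by their restrictions to the summands. The
summands of `(((A ∘ B) ∘ D) ∘ E)(j)` are given by lists of lists of lists. -/
theorem compCompComp_hom_ext (hP : P.PreservesCoproducts) {A B D E : Collection C} {j : ℕ} {Y : C}
    {f g : compObj P Q I (compObj P Q I (compObj P Q I A B) D) E j ⟶ Y}
    (H : ∀ (L : List (List (List ℕ))) (h : L.flatten.flatten.sum = j)
      (h' : (L.map (List.map List.length)).flatten.sum = L.flatten.flatten.length),
      P.hom (compCompι P Q I A B D (L.map (List.map List.length)) h') (𝟙 _) ≫
          compι P Q I _ E L.flatten.flatten h ≫ f =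
        P.hom (compCompι P Q I A B D (L.map (List.map List.length)) h') (𝟙 _) ≫
          compι P Q I _ E L.flatten.flatten h ≫ g) : f = g := by
  refine compObj_hom_ext P Q I fun l h => compObj_right_hom_ext hP fun l' h' =>
    compObj_right_right_hom_ext hP fun l'' h'' => ?_
  obtain ⟨K, rfl, rfl⟩ := exists_flatten_eq l'' l' h''
  obtain ⟨N, hN, rfl⟩ := exists_flatten_eq K.flatten l h'
  obtain ⟨L, hL, rfl⟩ := exists_flatten_eq (K.map List.length) N
    (by rw [← List.length_flatten, ← hN, List.length_map])
  obtain rfl : K = L.map (List.map List.length) := by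
    refine eq_of_flatten_eq ?_ (by rw [← hN, List.map_flatten])
    rw [← hL, List.map_map]
    exact List.map_congr_left fun x _ => (List.length_map _).symm
  have h1 := H L h h'
  simp only [compCompι] at h1
  rw [← Category.comp_id (𝟙 (tens Q I E L.flatten.flatten)), P.hom_comp, Category.assoc,
    Category.assoc] at h1
  exact h1

variable (e : Interchange P I Q I) (MP : LaxMonoidal P I)
  (M : LaxMonoidal Q I) (hM : ∀ X Y Z, IsIso (M.assoc X Y Z))

theorem exists_compAssoc (hP : P.PreservesCoproducts) (A B D : Collection C) (j : ℕ) :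
    ∃ f : compObj P Q I (compObj P Q I A B) D j ⟶ compObj P Q I A (compObj P Q I B D) j,
      ∀ L h, compCompι P Q I A B D L h ≫ f =
        MP.assoc (A (L.map List.length).length) (tens Q I B (L.map List.length))
            (tens Q I D L.flatten) ≫
          P.hom (castHom A (by simp)) (shuffle e M hM B D L) ≫
          compι P Q I A (compObj P Q I B D) (L.map List.sum) (List.sum_flatten.symm.trans h) :=
  exists_compComp_desc hP _

/-- The associator of the composition product. -/
noncomputable def compAssoc (hP : P.PreservesCoproducts) (A B D : Collection C) :
    compObj P Q I (compObj P Q I A B) D ⟶ compObj P Q I A (compObj P Q I B D) :=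
  fun j => (exists_compAssoc e MP M hM hP A B D j).choose

theorem compCompι_compAssoc (hP : P.PreservesCoproducts) (A B D : Collection C) {j : ℕ}
    (L : List (List ℕ)) (h : L.flatten.sum = j) :
    compCompι P Q I A B D L h ≫ compAssoc e MP M hM hP A B D j =
      MP.assoc (A (L.map List.length).length) (tens Q I B (L.map List.length))
          (tens Q I D L.flatten) ≫
        P.hom (castHom A (by simp)) (shuffle e M hM B D L) ≫
        compι P Q I A (compObj P Q I B D) (L.map List.sum) (List.sum_flatten.symm.trans h) :=
  (exists_compAssoc e MP M hM hP A B D j).choose_spec L h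

theorem compCompι_naturality {A A' B B' D D' : Collection C} (f : A ⟶ A') (g : B ⟶ B')
    (k : D ⟶ D') {j : ℕ} (L : List (List ℕ)) (h : L.flatten.sum = j) :
    compCompι P Q I A B D L h ≫ compHom P Q I (fun i => compHom P Q I f g i) k j =
      P.hom (P.hom (f _) (tensMap Q I g _)) (tensMap Q I k _) ≫ compCompι P Q I A' B' D' L h := by
  simp only [compCompι, Category.assoc]
  rw [compι_compHom, P.comp_hom_assoc, P.comp_hom_assoc, compι_compHom, Category.id_comp,
    Category.comp_id]

theorem compAssoc_naturality (hP : P.PreservesCoproducts) {A A' B B' D D' : Collection C}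
    (f : A ⟶ A') (g : B ⟶ B') (k : D ⟶ D') (j : ℕ) :
    compHom P Q I (fun i => compHom P Q I f g i) k j ≫ compAssoc e MP M hM hP A' B' D' j =
      compAssoc e MP M hM hP A B D j ≫ compHom P Q I f (fun i => compHom P Q I g k i) j := by
  refine compComp_hom_ext hP fun L h => ?_
  have h1 := shuffle_naturality e M hM g k L
  rw [reassoc_of% (compCompι_naturality f g k L h), compCompι_compAssoc,
    reassoc_of% (compCompι_compAssoc e MP M hM hP A B D L h), compι_compHom,
    MP.assoc_naturality_assoc, P.comp_hom_assoc, P.comp_hom_assoc, h1, castHom_naturality]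
  rfl

/-- The two ways of regrouping a list of lists of lists agree. This is the pentagon equation for
the composition product, with the outermost factor removed. -/
theorem shuffle_shuffle {e : Interchange P I Q I} {MP : LaxMonoidal P I} {M : LaxMonoidal Q I}
    (he : e.Normal MP M) (hM : ∀ X Y Z, IsIso (M.assoc X Y Z)) (hP : P.PreservesCoproducts)
    (B D E : Collection C) (L : List (List (List ℕ)))
    (h₁ : (L.map (List.map List.length)).map List.sum = (L.map List.flatten).map List.length)
    (h₂ : L.flatten.flatten = (L.map List.flatten).flatten)
    (h₃ : (L.map (List.map List.length)).map List.length =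
      (L.map (List.map List.sum)).map List.length)
    (h₄ : (L.map (List.map List.length)).flatten = L.flatten.map List.length)
    (h₅ : L.flatten.map List.sum = (L.map (List.map List.sum)).flatten)
    (h₆ : (L.map (List.map List.sum)).map List.sum = (L.map List.flatten).map List.sum) :
    P.hom (shuffle e M hM B D (L.map (List.map List.length)) ≫ tensCast Q I _ h₁)
          (tensCast Q I E h₂) ≫
        shuffle e M hM (compObj P Q I B D) E (L.map List.flatten) ≫
        tensMap Q I (compAssoc e MP M hM hP B D E) ((L.map List.flatten).map List.sum) =
      MP.assoc _ _ _ ≫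
        P.hom (tensCast Q I B h₃)
          (P.hom (tensCast Q I D h₄) (𝟙 _) ≫ shuffle e M hM D E L.flatten ≫ tensCast Q I _ h₅) ≫
        shuffle e M hM B (compObj P Q I D E) (L.map (List.map List.sum)) ≫
        tensCast Q I _ h₆ := by
  induction L with
  | nil =>
    dsimp only [tens, shuffle, List.map, List.flatten_nil, tensMap]
    simp only [tensCast_rfl, tens]
    simp only [P.hom_id, Category.id_comp, Category.comp_id, he.μ_eq]
    rw [← MP.triangle_left, Category.assoc, MP.leftUnitor_naturality]
  | cons T L ih =>
    have k₁ : (L.map (List.map List.length)).map List.sum =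
      (L.map List.flatten).map List.length := (List.cons.inj h₁).2
    have k₁' : (T.map List.length).sum = T.flatten.length := (List.cons.inj h₁).1
    have k₂ : L.flatten.flatten = (L.map List.flatten).flatten := List.flatten_flatten
    have k₃ : (L.map (List.map List.length)).map List.length =
      (L.map (List.map List.sum)).map List.length := (List.cons.inj h₃).2
    have k₃' : (T.map List.length).length = (T.map List.sum).length := (List.cons.inj h₃).1
    have k₄ : (L.map (List.map List.length)).flatten = L.flatten.map List.length :=
      List.map_flatten.symm
    have k₅ : L.flatten.map List.sum = (L.map (List.map List.sum)).flatten :=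
      List.map_flatten
    have k₆ : (L.map (List.map List.sum)).map List.sum = (L.map List.flatten).map List.sum :=
      (List.cons.inj h₆).2
    have k₆' : (T.map List.sum).sum = T.flatten.sum := (List.cons.inj h₆).1
    specialize ih k₁ k₂ k₃ k₄ k₅ k₆
    have hT := compCompι_compAssoc e MP M hM hP B D E T rfl
    have hap := shuffle_append e M hM he D E T L.flatten
    dsimp only [tens, shuffle, List.map, List.flatten_cons, tensMap] at *
    rw [tensCast_cons Q I _ k₁' k₁, tensCast_cons Q I _ k₃' k₃, tensCast_cons Q I _ k₆' k₆]
    simp only [Category.assoc, Q.comp_hom]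
    have hE : tensCast Q I E h₂ ≫ tensSplit M hM E T.flatten (L.map List.flatten).flatten =
        (tensCast Q I E List.flatten_append ≫ tensSplit M hM E T.flatten L.flatten.flatten) ≫
          Q.hom (𝟙 _) (tensCast Q I E k₂) := by
      have h := tensSplit_cast M hM E (rfl : T.flatten = T.flatten) k₂
        (congrArg (T.flatten ++ ·) k₂)
      rw [tensCast_rfl] at h
      rw [Category.assoc, ← h, ← Category.assoc, tensCast_trans]
    have hD : tensCast Q I D h₄ ≫ tensCast Q I D List.map_append ≫
        tensSplit M hM D (T.map List.length) (L.flatten.map List.length) =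
        tensSplit M hM D (T.map List.length) (L.map (List.map List.length)).flatten ≫
          Q.hom (𝟙 _) (tensCast Q I D k₄) := by
      have h := tensSplit_cast M hM D (rfl : T.map List.length = T.map List.length) k₄
        (congrArg (T.map List.length ++ ·) k₄)
      rw [tensCast_rfl] at h
      rw [← h, ← Category.assoc, tensCast_trans]
    have hDE : tensCast Q I (compObj P Q I D E) h₅ ≫
        tensSplit M hM (compObj P Q I D E) (T.map List.sum) (L.map (List.map List.sum)).flatten =
        tensCast Q I (compObj P Q I D E) List.map_append ≫
          tensSplit M hM (compObj P Q I D E) (T.map List.sum) (L.flatten.map List.sum) ≫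
          Q.hom (𝟙 _) (tensCast Q I _ k₅) := by
      have h := tensSplit_cast M hM (compObj P Q I D E) (rfl : T.map List.sum = T.map List.sum) k₅
        (congrArg (T.map List.sum ++ ·) k₅)
      rw [tensCast_rfl] at h
      rw [← h, ← Category.assoc, tensCast_trans]
    rw [P.comp_hom_assoc, P.comp_hom_assoc, Category.comp_id, Category.comp_id, hE]
    -- The induction step: `hT'` treats the first list of lists, `ih` the remaining ones.
    have hT' : P.hom (compι P Q I B D (T.map List.length) rfl ≫ castHom _ k₁') (𝟙 _) ≫
        compι P Q I (compObj P Q I B D) E T.flatten rfl ≫ compAssoc e MP M hM hP B D E _ =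
        MP.assoc _ _ _ ≫ P.hom (castHom B k₃') (shuffle e M hM D E T) ≫
          compι P Q I B (compObj P Q I D E) (T.map List.sum) k₆' := by
      rw [compι_castHom, ← hT, compCompι, Category.assoc]
    refine (he.interchange_assoc _ _ _ _ _ _ _ _ _ _ _ _ _ _ hT' ih).trans ?_
    rw [compι_castHom]
    simp only [Category.assoc]
    rw [hDE, reassoc_of% hap, P.comp_hom_assoc, Category.id_comp, hD, Q.comp_hom]
    have hη : P.hom (tensSplit M hM D (T.map List.length) (L.map (List.map List.length)).flatten ≫
          Q.hom (𝟙 _) (tensCast Q I D k₄))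
        (tensCast Q I E List.flatten_append ≫ tensSplit M hM E T.flatten L.flatten.flatten) =
        P.hom (tensSplit M hM D (T.map List.length) (L.map (List.map List.length)).flatten)
          (tensCast Q I E List.flatten_append ≫ tensSplit M hM E T.flatten L.flatten.flatten) ≫
        P.hom (Q.hom (𝟙 _) (tensCast Q I D k₄)) (Q.hom (𝟙 _) (𝟙 _)) := by
      rw [P.comp_hom, Q.hom_id, Category.comp_id]
    rw [hη, Category.assoc, e.η_naturality_assoc, Q.comp_hom, P.hom_id, Category.id_comp,
      Category.comp_id]

/-- The inclusion of a summand whose index is given as a pair of lists. The triple composites need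
it, since there such a pair is only propositionally equal to the pair obtained from a list of
lists. -/
theorem cast_compCompι (P Q : Product C) (I : C) (A B D : Collection C) {j : ℕ} {l l' : List ℕ}
    (h' : l'.sum = l.length) (h : l.sum = j) (K : List (List ℕ)) (h₁ : l' = K.map List.length)
    (h₂ : l = K.flatten) (h₃ : l'.length = (K.map List.length).length) (h₄ : K.flatten.sum = j) :
    P.hom (compι P Q I A B l' h') (𝟙 _) ≫ compι P Q I (compObj P Q I A B) D l h =
      P.hom (P.hom (castHom A h₃) (tensCast Q I B h₁)) (tensCast Q I D h₂) ≫
        compCompι P Q I A B D K h₄ := by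
  subst h₁ h₂; simp [P.hom_id, compCompι]

theorem compAssoc_pentagon {e : Interchange P I Q I} {MP : LaxMonoidal P I} {M : LaxMonoidal Q I}
    (he : e.Normal MP M) (hM : ∀ X Y Z, IsIso (M.assoc X Y Z)) (hP : P.PreservesCoproducts)
    (A B D E : Collection C) (j : ℕ) :
    compHom P Q I (compAssoc e MP M hM hP A B D) (𝟙 E) j ≫
        compAssoc e MP M hM hP A (compObj P Q I B D) E j ≫
        compHom P Q I (𝟙 A) (compAssoc e MP M hM hP B D E) j =
      compAssoc e MP M hM hP (compObj P Q I A B) D E j ≫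
        compAssoc e MP M hM hP A B (compObj P Q I D E) j := by
  refine compCompComp_hom_ext hP fun L h h' => ?_
  have h₁ : (L.map (List.map List.length)).map List.sum =
      (L.map List.flatten).map List.length := by simp [List.length_flatten]
  have h₂ : L.flatten.flatten = (L.map List.flatten).flatten := List.flatten_flatten
  have h₃ : (L.map (List.map List.length)).map List.length =
      (L.map (List.map List.sum)).map List.length := by simp
  have h₄ : (L.map (List.map List.length)).flatten = L.flatten.map List.length :=
    List.map_flatten.symm
  have h₅ : L.flatten.map List.sum = (L.map (List.map List.sum)).flatten := List.map_flatten
  have h₆ : (L.map (List.map List.sum)).map List.sum = (L.map List.flatten).map List.sum := by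
    simp [List.sum_flatten]
  have h₇ : (L.map (List.map List.sum)).flatten.sum = j := by
    rw [← h₅, ← List.sum_flatten]; exact h
  have h₈ : (L.map List.flatten).flatten.sum = j := h₂ ▸ h
  have h₉ : (L.map (List.map List.length)).length = (L.map List.flatten).length := by simp
  have h₁₀ : ((L.map (List.map List.length)).map List.length).length =
      ((L.map List.flatten).map List.sum).length := by simp
  have h₁₁ : ((L.map (List.map List.length)).map List.length).length =
      ((L.map (List.map List.length)).map List.sum).length := by simp
  have hs := shuffle_shuffle he hM hP B D E L h₁ h₂ h₃ h₄ h₅ h₆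
  have c₁ := compCompι_compAssoc e MP M hM hP A B D (L.map (List.map List.length)) h'
  have c₂ := compCompι_compAssoc e MP M hM hP A (compObj P Q I B D) E (L.map List.flatten) h₈
  have c₃ := compCompι_compAssoc e MP M hM hP (compObj P Q I A B) D E L.flatten h
  have c₄ := compCompι_compAssoc e MP M hM hP A B (compObj P Q I D E) (L.map (List.map List.sum))
    h₇
  have d₁ := cast_compCompι P Q I A (compObj P Q I B D) E
    (l' := (L.map (List.map List.length)).map List.sum) (l := L.flatten.flatten)
    (List.sum_flatten.symm.trans h') h (L.map List.flatten) h₁ h₂ (by simp) h₈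
  have d₂ := cast_compCompι P Q I (compObj P Q I A B) D E h' h L.flatten h₄ rfl
    (congrArg List.length h₄) h
  have d₃ := cast_compCompι P Q I A B (compObj P Q I D E)
    (l' := (L.map (List.map List.length)).map List.length) (l := L.flatten.map List.sum)
    (by rw [← List.length_flatten, h₄, List.length_map, List.length_map])
    (List.sum_flatten.symm.trans h) (L.map (List.map List.sum)) h₃ h₅ (by simp) h₇
  -- Both sides start with an associator of `P`, which the pentagon for `P` identifies, and continue
  -- with the two sides of `shuffle_shuffle`.
  have lhs : P.hom (compCompι P Q I A B D (L.map (List.map List.length)) h') (𝟙 _) ≫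
        compι P Q I _ E L.flatten.flatten h ≫
        compHom P Q I (compAssoc e MP M hM hP A B D) (𝟙 E) j ≫
        compAssoc e MP M hM hP A (compObj P Q I B D) E j ≫
        compHom P Q I (𝟙 A) (compAssoc e MP M hM hP B D E) j =
      P.hom (MP.assoc _ _ _) (𝟙 _) ≫ MP.assoc _ _ _ ≫ P.hom (castHom A h₁₀)
        (P.hom (shuffle e M hM B D (L.map (List.map List.length)) ≫ tensCast Q I _ h₁)
          (tensCast Q I E h₂) ≫ shuffle e M hM (compObj P Q I B D) E (L.map List.flatten) ≫
        tensMap Q I (compAssoc e MP M hM hP B D E) ((L.map List.flatten).map List.sum)) ≫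
        compι P Q I A (compObj P Q I B (compObj P Q I D E)) ((L.map List.flatten).map List.sum)
          (List.sum_flatten.symm.trans h₈) := by
    rw [reassoc_of% (compι_compHom P Q I (compAssoc e MP M hM hP A B D) (𝟙 E) L.flatten.flatten h),
      P.comp_hom_assoc, c₁, tensMap_id]
    have hd : P.hom (MP.assoc _ _ _ ≫ P.hom (castHom A h₁₁)
          (shuffle e M hM B D (L.map (List.map List.length))) ≫
          compι P Q I A (compObj P Q I B D) ((L.map (List.map List.length)).map List.sum)
            (List.sum_flatten.symm.trans h')) (𝟙 (tens Q I E L.flatten.flatten) ≫ 𝟙 _) =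
        P.hom (MP.assoc _ _ _) (𝟙 _) ≫ P.hom (P.hom (castHom A h₁₁)
          (shuffle e M hM B D (L.map (List.map List.length)))) (𝟙 _) ≫
          P.hom (compι P Q I A (compObj P Q I B D) ((L.map (List.map List.length)).map List.sum)
            (List.sum_flatten.symm.trans h')) (𝟙 (tens Q I E L.flatten.flatten)) := by
      simp only [P.comp_hom, Category.comp_id]
    rw [hd]
    simp only [Category.assoc]
    rw [reassoc_of% d₁, reassoc_of% c₂, compι_compHom]
    refine congrArg (P.hom (MP.assoc _ _ _) (𝟙 _) ≫ ·) ?_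
    rw [P.comp_hom_assoc, P.comp_hom, MP.assoc_naturality_assoc, P.comp_hom_assoc,
      P.comp_hom_assoc]
    simp only [Pi.id_apply, Category.comp_id, Category.id_comp, castHom_trans, Category.assoc]
  have rhs : P.hom (compCompι P Q I A B D (L.map (List.map List.length)) h') (𝟙 _) ≫
        compι P Q I _ E L.flatten.flatten h ≫ compAssoc e MP M hM hP (compObj P Q I A B) D E j ≫
        compAssoc e MP M hM hP A B (compObj P Q I D E) j =
      MP.assoc _ _ _ ≫ MP.assoc _ _ _ ≫ P.hom (castHom A h₁₀)
        (P.hom (tensCast Q I B h₃)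
          (P.hom (tensCast Q I D h₄) (𝟙 _) ≫ shuffle e M hM D E L.flatten ≫ tensCast Q I _ h₅) ≫
        shuffle e M hM B (compObj P Q I D E) (L.map (List.map List.sum)) ≫
        tensCast Q I _ h₆) ≫
        compι P Q I A (compObj P Q I B (compObj P Q I D E)) ((L.map List.flatten).map List.sum)
          (List.sum_flatten.symm.trans h₈) := by
    have hd : P.hom (compCompι P Q I A B D (L.map (List.map List.length)) h')
          (𝟙 (tens Q I E L.flatten.flatten)) =
        P.hom (P.hom (compι P Q I A B _ List.length_flatten.symm) (𝟙 _)) (𝟙 _) ≫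
          P.hom (compι P Q I (compObj P Q I A B) D _ h') (𝟙 _) := by
      rw [P.comp_hom, Category.comp_id, compCompι]
    rw [hd, Category.assoc, reassoc_of% d₂, reassoc_of% c₃, P.comp_hom_assoc, P.comp_hom,
      MP.assoc_naturality_assoc, P.comp_hom_assoc, Category.assoc, castHom_trans, compι_castHom,
      tensCast_rfl, Category.id_comp, Category.id_comp]
    refine congrArg (MP.assoc _ _ _ ≫ ·) ?_
    rw [← Category.comp_id (P.hom (tensCast Q I D h₄) _ ≫ _),
      ← Category.id_comp (compι P Q I A B _ _),
      ← P.comp_hom_assoc, reassoc_of% d₃, c₄, P.comp_hom_assoc,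
      ← cast_compι P Q I A (compObj P Q I B (compObj P Q I D E)) h₆ (by simp)
        (List.sum_flatten.symm.trans h₈)]
    simp only [Category.assoc, P.comp_hom_assoc, Category.id_comp]
    rw [MP.assoc_naturality_assoc, P.comp_hom_assoc, castHom_trans, castHom_trans]
  have hp := MP.pentagon (A ((L.map (List.map List.length)).map List.length).length)
    (tens Q I B ((L.map (List.map List.length)).map List.length))
    (tens Q I D (L.map (List.map List.length)).flatten) (tens Q I E L.flatten.flatten)
  rw [lhs, rhs, hs, ← reassoc_of% hp, P.comp_hom_assoc, Category.id_comp]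

end Assoc

/-! ### The units of the composition product -/

section Units

variable [HasCoproducts.{0} C] {P Q : Product C} {I : C}

theorem isInitial_unitCollection (I : C) {k : ℕ} (hk : k ≠ 1) :
    Nonempty (IsInitial (unitCollection I k)) := by
  rw [unitCollection, if_neg hk]
  exact ⟨initialIsInitial⟩

/-- The components of the map `(∅, I, ∅, ∅, …) ⟶ (I, I, I, …)` which is the identity of `I` in
degree one. -/
noncomputable def unitTo (I : C) (j : ℕ) : unitCollection I j ⟶ I :=
  if h : j = 1 then eqToHom (if_pos h) else eqToHom (if_neg h) ≫ initial.to I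

instance isIso_unitTo (I : C) : IsIso (unitTo I 1) := by
  rw [unitTo, dif_pos rfl]
  exact inferInstanceAs (IsIso (𝟙 I))

/-- The canonical map from a tensor product of copies of `I` to `I`. -/
def tensConst (M : LaxMonoidal Q I) : (l : List ℕ) → (tens Q I (constCollection I) l ⟶ I)
  | [] => 𝟙 I
  | _ :: l => Q.hom (𝟙 I) (tensConst M l) ≫ (M.leftUnitor I).hom

instance isIso_tensConst (M : LaxMonoidal Q I) (l : List ℕ) : IsIso (tensConst M l) := by
  induction l with
  | nil => exact inferInstanceAs (IsIso (𝟙 I))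
  | cons j l ih => exact inferInstanceAs (IsIso (Q.hom (𝟙 I) (tensConst M l) ≫ _))

/-- The canonical map from a tensor product of entries of `(∅, I, ∅, ∅, …)` to `I`. -/
noncomputable def tensUnit (M : LaxMonoidal Q I) :
    (l : List ℕ) → (tens Q I (unitCollection I) l ⟶ I)
  | [] => 𝟙 I
  | j :: l => Q.hom (unitTo I j) (tensUnit M l) ≫ (M.leftUnitor I).hom

theorem isIso_tensUnit (M : LaxMonoidal Q I) {l : List ℕ} (hl : ∀ i ∈ l, i = 1) :
    IsIso (tensUnit M l) := by
  induction l with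
  | nil => exact inferInstanceAs (IsIso (𝟙 I))
  | cons j l ih =>
    obtain rfl := hl j List.mem_cons_self
    have := ih fun i hi => hl i (List.mem_cons_of_mem _ hi)
    exact inferInstanceAs (IsIso (Q.hom (unitTo I 1) (tensUnit M l) ≫ _))

/-- A tensor product with an initial factor is initial. -/
theorem isInitial_tens_unit (hQ : Q.PreservesCoproducts) {l : List ℕ} (hl : ¬ ∀ i ∈ l, i = 1) :
    Nonempty (IsInitial (tens Q I (unitCollection I) l)) := by
  induction l with
  | nil => simp at hl
  | cons j l ih =>
    by_cases hj : j = 1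
    · refine hQ.isInitial_right _ (ih fun h => hl ?_)
      simpa [hj] using h
    · exact hQ.isInitial_left (isInitial_unitCollection I hj) _

theorem tensUnit_append (M : LaxMonoidal Q I) (hM : ∀ X Y Z, IsIso (M.assoc X Y Z))
    (l l' : List ℕ) :
    tensSplit M hM (unitCollection I) l l' ≫ Q.hom (tensUnit M l) (tensUnit M l') ≫
      (M.leftUnitor I).hom = tensUnit M (l ++ l') := by
  induction l with
  | nil =>
    dsimp only [tensSplit, tens, List.nil_append, tensUnit]
    rw [M.leftUnitor_naturality, Iso.inv_hom_id_assoc]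
  | cons j l ih =>
    have h {X Y Z : C} (f : X ⟶ I) (g : Y ⟶ I) (k : Z ⟶ I) :
        Q.hom (Q.hom f g ≫ (M.leftUnitor I).hom) k ≫ (M.leftUnitor I).hom =
          M.assoc _ _ _ ≫ Q.hom f (Q.hom g k ≫ (M.leftUnitor I).hom) ≫
            (M.leftUnitor I).hom := by
      rw [← Category.comp_id k, Q.hom_comp, ← M.triangle_left, Category.comp_id, Category.assoc,
        Category.assoc, ← M.leftUnitor_naturality, M.assoc_naturality_assoc, Q.comp_hom_assoc,
        Category.comp_id]
    dsimp only [tensSplit, tens, List.cons_append, tensUnit]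
    have e := hM (unitCollection I j) (tens Q I (unitCollection I) l)
      (tens Q I (unitCollection I) l')
    rw [h, Category.assoc, IsIso.inv_hom_id_assoc, Q.comp_hom_assoc, ih, Category.id_comp]

/-- The inclusion of a summand is an isomorphism if all other summands are initial. -/
theorem isIso_compι {A B : Collection C} {j : ℕ} (l : List ℕ) (h : l.sum = j)
    (H : ∀ l' : List ℕ, l'.sum = j → l' ≠ l →
      Nonempty (IsInitial (P.obj (A l'.length) (tens Q I B l')))) :
    IsIso (compι P Q I A B l h) := by
  classical
  choose f hf using fun (l' : List ℕ) (h' : l'.sum = j) =>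
    show ∃ f : P.obj (A l'.length) (tens Q I B l') ⟶ P.obj (A l.length) (tens Q I B l),
      ∀ hl : l' = l, f = eqToHom (by rw [hl]) by
    by_cases hl : l' = l
    · exact ⟨eqToHom (by rw [hl]), fun _ => rfl⟩
    · exact ⟨(H l' h' hl).some.to _, fun hl' => absurd hl' hl⟩
  have hι : ∀ l' h', compι P Q I A B l' h' ≫ Sigma.desc (fun l => f l.1 l.2) = f l' h' :=
    fun l' h' => Sigma.ι_desc (fun l : {l : List ℕ // l.sum = j} => f l.1 l.2) ⟨l', h'⟩
  refine ⟨Sigma.desc fun l => f l.1 l.2, (hι l h).trans (hf l h rfl), ?_⟩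
  refine compObj_hom_ext P Q I fun l' h' => ?_
  refine ((Category.assoc _ _ _).symm.trans
    (congrArg (· ≫ compι P Q I A B l h) (hι l' h'))).trans ?_
  rw [Category.comp_id]
  by_cases hl : l' = l
  · subst hl
    rw [hf l' h' rfl, eqToHom_refl, Category.id_comp]
  · exact hom_ext_of_isInitial (H l' h' hl) _ _

theorem isIso_compι_unit_left (hP : P.PreservesCoproducts) (A : Collection C) (j : ℕ) :
    IsIso (compι P Q I (unitCollection I) A [j] List.sum_singleton) := by
  refine isIso_compι _ _ fun l h hl =>
    hP.isInitial_left (isInitial_unitCollection I fun hk => hl ?_) _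
  obtain ⟨x, rfl⟩ := List.length_eq_one_iff.1 hk
  rw [← h, List.sum_singleton]

theorem sum_replicate_one (j : ℕ) : (List.replicate j 1).sum = j := by
  simp

theorem isIso_compι_unit_right (hP : P.PreservesCoproducts) (hQ : Q.PreservesCoproducts)
    (A : Collection C) (j : ℕ) :
    IsIso (compι P Q I A (unitCollection I) (List.replicate j 1) (sum_replicate_one j)) := by
  refine isIso_compι _ _ fun l h hl => hP.isInitial_right _ (isInitial_tens_unit hQ fun hk => hl ?_)
  have := List.eq_replicate_of_mem hk
  rw [this, List.sum_replicate, smul_eq_mul, mul_one] at h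
  rw [this, h]

/-- The left unit isomorphism `(I ∘ A)(j) ⟶ A(j)`: only the summand `I ⊗ (A(j) ⊗ I)` is not
initial. -/
noncomputable def compLeftUnitorHom (MP : LaxMonoidal P I) (MQ : LaxMonoidal Q I)
    (hP : P.PreservesCoproducts) (A : Collection C) (j : ℕ) :
    compObj P Q I (unitCollection I) A j ⟶ A j :=
  have := isIso_compι_unit_left (Q := Q) (I := I) hP A j
  inv (compι P Q I (unitCollection I) A [j] List.sum_singleton) ≫
    P.hom (unitTo I 1) (MQ.rightUnitor (A j)).hom ≫ (MP.leftUnitor (A j)).hom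

instance isIso_compLeftUnitorHom (MP : LaxMonoidal P I) (MQ : LaxMonoidal Q I)
    (hP : P.PreservesCoproducts) (A : Collection C) (j : ℕ) :
    IsIso (compLeftUnitorHom MP MQ hP A j) := by
  have := isIso_compι_unit_left (Q := Q) (I := I) hP A j
  have h : IsIso (P.hom (unitTo I 1) (MQ.rightUnitor (A j)).hom ≫ (MP.leftUnitor (A j)).hom) :=
    inferInstance
  exact IsIso.comp_isIso' inferInstance h

theorem compι_compLeftUnitorHom (MP : LaxMonoidal P I) (MQ : LaxMonoidal Q I)
    (hP : P.PreservesCoproducts) (A : Collection C) {i j : ℕ} (h : [i].sum = j) (hij : i = j) :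
    compι P Q I (unitCollection I) A [i] h ≫ compLeftUnitorHom MP MQ hP A j =
      P.hom (unitTo I 1) (MQ.rightUnitor (A i)).hom ≫ (MP.leftUnitor (A i)).hom ≫
        castHom A hij := by
  subst hij
  have := isIso_compι_unit_left (Q := Q) (I := I) hP A i
  rw [castHom_rfl, Category.comp_id]
  exact IsIso.hom_inv_id_assoc _ _

/-- The right unit isomorphism `(A ∘ I)(j) ⟶ A(j)`: only the summand `A(j) ⊗ (I ⊗ ⋯ ⊗ I)` is not
initial. -/
noncomputable def compRightUnitorHom (MP : LaxMonoidal P I) (MQ : LaxMonoidal Q I)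
    (hP : P.PreservesCoproducts) (hQ : Q.PreservesCoproducts) (A : Collection C) (j : ℕ) :
    compObj P Q I A (unitCollection I) j ⟶ A j :=
  have := isIso_compι_unit_right (P := P) (I := I) hP hQ A j
  inv (compι P Q I A (unitCollection I) (List.replicate j 1) (sum_replicate_one j)) ≫
    P.hom (castHom A List.length_replicate) (tensUnit MQ (List.replicate j 1)) ≫
    (MP.rightUnitor (A j)).hom

instance isIso_castHom (A : Collection C) {i j : ℕ} (h : i = j) : IsIso (castHom A h) := by
  subst h; rw [castHom_rfl]; infer_instance

instance isIso_compRightUnitorHom (MP : LaxMonoidal P I) (MQ : LaxMonoidal Q I)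
    (hP : P.PreservesCoproducts) (hQ : Q.PreservesCoproducts) (A : Collection C) (j : ℕ) :
    IsIso (compRightUnitorHom MP MQ hP hQ A j) := by
  have := isIso_compι_unit_right (P := P) (I := I) hP hQ A j
  have := isIso_tensUnit MQ (l := List.replicate j 1) fun i hi => List.eq_of_mem_replicate hi
  rw [compRightUnitorHom]
  infer_instance

theorem compι_compRightUnitorHom (MP : LaxMonoidal P I) (MQ : LaxMonoidal Q I)
    (hP : P.PreservesCoproducts) (hQ : Q.PreservesCoproducts) (A : Collection C) {j : ℕ}
    (l : List ℕ) (h : l.sum = j) (hl : l.length = j) :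
    compι P Q I A (unitCollection I) l h ≫ compRightUnitorHom MP MQ hP hQ A j =
      P.hom (castHom A hl) (tensUnit MQ l) ≫ (MP.rightUnitor (A j)).hom := by
  by_cases h1 : ∀ i ∈ l, i = 1
  · obtain rfl : l = List.replicate j 1 := hl ▸ List.eq_replicate_of_mem h1
    have := isIso_compι_unit_right (P := P) (I := I) hP hQ A j
    exact IsIso.hom_inv_id_assoc _ _
  · exact hom_ext_of_isInitial (hP.isInitial_right _ (isInitial_tens_unit hQ h1)) _ _

theorem compObj_unit_left_hom_ext (hP : P.PreservesCoproducts) {A : Collection C} {j : ℕ} {X : C}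
    {f g : compObj P Q I (unitCollection I) A j ⟶ X}
    (H : compι P Q I (unitCollection I) A [j] List.sum_singleton ≫ f =
      compι P Q I (unitCollection I) A [j] List.sum_singleton ≫ g) : f = g := by
  have := isIso_compι_unit_left (Q := Q) (I := I) hP A j
  exact (cancel_epi _).1 H

theorem compObj_unit_right_hom_ext (hP : P.PreservesCoproducts) (hQ : Q.PreservesCoproducts)
    {A : Collection C} {j : ℕ} {X : C} {f g : compObj P Q I A (unitCollection I) j ⟶ X}
    (H : ∀ (l : List ℕ) (h : l.sum = j), l.length = j →
      compι P Q I A (unitCollection I) l h ≫ f = compι P Q I A (unitCollection I) l h ≫ g) :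
    f = g := by
  have := isIso_compι_unit_right (P := P) (I := I) hP hQ A j
  exact (cancel_epi _).1 (H (List.replicate j 1) (sum_replicate_one j) List.length_replicate)

theorem compLeftUnitorHom_naturality (MP : LaxMonoidal P I) (MQ : LaxMonoidal Q I)
    (hP : P.PreservesCoproducts) {A B : Collection C} (f : A ⟶ B) (j : ℕ) :
    compHom P Q I (𝟙 (unitCollection I)) f j ≫ compLeftUnitorHom MP MQ hP B j =
      compLeftUnitorHom MP MQ hP A j ≫ f j := by
  refine compObj_unit_left_hom_ext hP ?_
  have h := compι_compLeftUnitorHom MP MQ hP A (List.sum_singleton (x := j)) rfl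
  have h' := compι_compLeftUnitorHom MP MQ hP B (List.sum_singleton (x := j)) rfl
  rw [reassoc_of% (compι_compHom P Q I (𝟙 (unitCollection I)) f [j] List.sum_singleton),
    h', reassoc_of% h]
  dsimp only [tensMap, tens, List.length]
  simp only [castHom_rfl, Category.comp_id, Category.assoc]
  rw [← MP.leftUnitor_naturality, P.comp_hom_assoc, MQ.rightUnitor_naturality]
  rw [P.comp_hom_assoc, Category.comp_id]
  exact congrArg (fun t => P.hom t _ ≫ _) (Category.id_comp (unitTo I 1))

theorem compRightUnitorHom_naturality (MP : LaxMonoidal P I) (MQ : LaxMonoidal Q I)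
    (hP : P.PreservesCoproducts) (hQ : Q.PreservesCoproducts) {A B : Collection C} (f : A ⟶ B)
    (j : ℕ) :
    compHom P Q I f (𝟙 (unitCollection I)) j ≫ compRightUnitorHom MP MQ hP hQ B j =
      compRightUnitorHom MP MQ hP hQ A j ≫ f j := by
  refine compObj_unit_right_hom_ext hP hQ fun l h hl => ?_
  rw [reassoc_of% (compι_compHom P Q I f (𝟙 (unitCollection I)) l h),
    compι_compRightUnitorHom MP MQ hP hQ B l h hl,
    reassoc_of% (compι_compRightUnitorHom MP MQ hP hQ A l h hl), tensMap_id,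
    ← MP.rightUnitor_naturality, P.comp_hom_assoc, P.comp_hom_assoc, castHom_naturality,
    Category.id_comp, Category.comp_id]

/-- For a list `t` of length one, `⊗ A(t)` is `A(∑ t)`, compatibly with splittings. -/
theorem exists_tens_singleton_map (MP : LaxMonoidal P I) (M : LaxMonoidal Q I)
    (hM : ∀ X Y Z, IsIso (M.assoc X Y Z)) (hP : P.PreservesCoproducts) (A : Collection C)
    (t : List ℕ) (ht : t.length = 1) :
    ∃ r : tens Q I A t ⟶ A t.sum,
      compι P Q I (unitCollection I) A t rfl ≫ compLeftUnitorHom MP M hP A t.sum =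
          P.hom (unitTo I t.length) r ≫ (MP.leftUnitor (A t.sum)).hom ∧
        ∀ (l : List ℕ) (h : t ++ l = t.sum :: l),
          tensSplit M hM A t l ≫ Q.hom r (𝟙 _) = tensCast Q I A h := by
  obtain ⟨x, rfl⟩ := List.length_eq_one_iff.1 ht
  have hx : x = [x].sum := List.sum_singleton.symm
  refine ⟨(M.rightUnitor (A x)).hom ≫ castHom A hx, ?_, fun l h => ?_⟩
  · refine (compι_compLeftUnitorHom MP M hP A rfl hx).trans ?_
    rw [← MP.leftUnitor_naturality, P.comp_hom_assoc, Category.comp_id]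
    rfl
  · have := hM (A x) I (tens Q I A l)
    have h1 : tensSplit M hM A [x] l =
      Q.hom (𝟙 (A x)) (M.leftUnitor (tens Q I A l)).inv ≫ inv (M.assoc (A x) I (tens Q I A l)) :=
      rfl
    have h2 : Q.hom ((M.rightUnitor (A x)).hom ≫ castHom A hx) (𝟙 (tens Q I A l)) =
        M.assoc _ _ _ ≫ Q.hom (𝟙 _) (M.leftUnitor _).hom ≫ Q.hom (castHom A hx) (𝟙 _) := by
      rw [reassoc_of% (M.triangle (A x) (tens Q I A l)), Q.comp_hom, Category.comp_id]
    have h3 : Q.hom (castHom A hx) (𝟙 (tens Q I A l)) = tensCast Q I A h :=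
      (tensCast_cons Q I A hx rfl h).symm
    rw [h1]
    refine (congrArg ((Q.hom (𝟙 (A x)) (M.leftUnitor (tens Q I A l)).inv ≫
      inv (M.assoc (A x) I (tens Q I A l))) ≫ ·) h2).trans ?_
    rw [Category.assoc, IsIso.inv_hom_id_assoc, Q.comp_hom_assoc, Iso.inv_hom_id,
      Category.comp_id, Q.hom_id, Category.id_comp, h3]

/-- The shuffle of a list of lists of length one, followed by the left unit isomorphisms. -/
theorem shuffle_unit_left {e : Interchange P I Q I} {MP : LaxMonoidal P I} {M : LaxMonoidal Q I}
    (he : e.Normal MP M) (hM : ∀ X Y Z, IsIso (M.assoc X Y Z)) (hP : P.PreservesCoproducts)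
    (A : Collection C) (L : List (List ℕ)) (hL : ∀ t ∈ L, t.length = 1)
    (h : L.flatten = L.map List.sum) :
    shuffle e M hM (unitCollection I) A L ≫
        tensMap Q I (fun j => compLeftUnitorHom MP M hP A j) (L.map List.sum) =
      P.hom (tensUnit M (L.map List.length)) (tensCast Q I A h) ≫ (MP.leftUnitor _).hom := by
  induction L with
  | nil =>
    dsimp only [shuffle, tensMap, List.map, tensUnit, tens, List.flatten_nil]
    simp only [tensCast_rfl, tens]
    rw [P.hom_id, he.μ_eq, Category.comp_id, Category.id_comp]
  | cons t L ih =>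
    have ht := hL t List.mem_cons_self
    have hL' : L.flatten = L.map List.sum := by
      obtain ⟨x, rfl⟩ := List.length_eq_one_iff.1 ht
      exact (List.cons.inj h).2
    specialize ih (fun t ht => hL t (List.mem_cons_of_mem _ ht)) hL'
    obtain ⟨r, h1, h2⟩ := exists_tens_singleton_map MP M hM hP A t ht
    have h3 : t ++ L.flatten = t.sum :: L.flatten := h.trans (by rw [hL']; rfl)
    specialize h2 L.flatten h3
    dsimp only [shuffle, tensMap, List.map, tensUnit, tens, List.flatten_cons] at h2 ⊢
    have h4 : Q.hom (P.hom (unitTo I t.length) r ≫ (MP.leftUnitor (A t.sum)).hom)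
        (P.hom (tensUnit M (L.map List.length)) (tensCast Q I A hL') ≫
          (MP.leftUnitor (tens Q I A (L.map List.sum))).hom) =
        Q.hom (P.hom (unitTo I t.length) r)
          (P.hom (tensUnit M (L.map List.length)) (tensCast Q I A hL')) ≫
          Q.hom (MP.leftUnitor (A t.sum)).hom (MP.leftUnitor (tens Q I A (L.map List.sum))).hom :=
      Q.hom_comp _ _ _ _
    have h5 : Q.hom r (tensCast Q I A hL') = Q.hom r (𝟙 _) ≫ Q.hom (𝟙 _) (tensCast Q I A hL') := by
      rw [Q.comp_hom, Category.id_comp, Category.comp_id]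
    have h6 := tensCast_cons Q I A (rfl : t.sum = t.sum) hL' (congrArg (t.sum :: ·) hL')
    rw [castHom_rfl] at h6
    dsimp only [tens] at h6
    rw [Category.assoc, Category.assoc, Q.comp_hom, ih, h1, h4, ← e.η_naturality_assoc,
      he.η_unit_left, P.comp_hom_assoc, P.comp_hom_assoc, h5, reassoc_of% h2, ← h6]
    rw [Category.id_comp, Category.comp_id]
    exact congrArg (fun s => P.hom _ s ≫ (MP.leftUnitor _).hom) (tensCast_trans Q I A h3 _)

/-- The shuffle of `A` with the unit collection, followed by the right unit isomorphisms. If `L` is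
not made up of lists of ones, then both sides are maps out of an initial object. -/
theorem shuffle_unit_right {e : Interchange P I Q I} {MP : LaxMonoidal P I} {M : LaxMonoidal Q I}
    (he : e.Normal MP M) (hM : ∀ X Y Z, IsIso (M.assoc X Y Z)) (hP : P.PreservesCoproducts)
    (hQ : Q.PreservesCoproducts) (A : Collection C) (L : List (List ℕ))
    (h : L.map List.length = L.map List.sum) :
    shuffle e M hM A (unitCollection I) L ≫
        tensMap Q I (fun j => compRightUnitorHom MP M hP hQ A j) (L.map List.sum) =
      P.hom (tensCast Q I A h) (tensUnit M L.flatten) ≫ (MP.rightUnitor _).hom := by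
  induction L with
  | nil =>
    dsimp only [shuffle, tensMap, List.map, tensUnit, tens, List.flatten_nil]
    simp only [tensCast_rfl, tens]
    rw [P.hom_id, he.μ_eq, Category.comp_id, Category.id_comp, MP.rightUnitor_unit]
  | cons t L ih =>
    have ht : t.length = t.sum := (List.cons.inj h).1
    have hL' : L.map List.length = L.map List.sum := (List.cons.inj h).2
    specialize ih hL'
    have h1 := compι_compRightUnitorHom MP M hP hQ A t rfl ht
    have h2 := tensUnit_append M hM t L.flatten
    dsimp only [shuffle, tensMap, List.map, tensUnit, tens, List.flatten_cons]
    rw [Category.assoc, Category.assoc, Q.comp_hom, ih, h1, tensCast_cons Q I A ht hL', Q.hom_comp,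
      ← e.η_naturality_assoc, he.η_unit_right, P.comp_hom_assoc, P.comp_hom_assoc, Category.assoc,
      Category.assoc, h2, Category.id_comp, Category.comp_id]

/-- For a single list the shuffle is the inclusion of a summand, up to unit isomorphisms. -/
theorem shuffle_singleton {e : Interchange P I Q I} {MP : LaxMonoidal P I} {M : LaxMonoidal Q I}
    (he : e.Normal MP M) (hM : ∀ X Y Z, IsIso (M.assoc X Y Z)) (B A : Collection C) (t : List ℕ) :
    shuffle e M hM B A [t] ≫ (M.rightUnitor (compObj P Q I B A t.sum)).hom =
      P.hom (M.rightUnitor (B t.length)).hom (tensCast Q I A (List.append_nil t)) ≫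
        compι P Q I B A t rfl := by
  have h := he.external_unit_right (B t.length) (tens Q I A t)
  dsimp only [shuffle, List.map, tens, List.flatten_cons, List.flatten_nil]
  have h1 : Q.hom (compι P Q I B A t rfl) e.μ ≫ (M.rightUnitor _).hom =
      Q.hom (𝟙 _) e.μ ≫ (M.rightUnitor _).hom ≫ compι P Q I B A t rfl := by
    rw [← M.rightUnitor_naturality, Q.comp_hom_assoc, Category.id_comp, Category.comp_id]
  have h2 (s : tens Q I A (t ++ []) ⟶ Q.obj (tens Q I A t) I)
      (hs : s ≫ (M.rightUnitor _).hom = tensCast Q I A (List.append_nil t)) :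
      (P.hom (𝟙 (Q.obj (B t.length) I)) s ≫ e.η (B t.length) I (tens Q I A t) I ≫
        Q.hom (compι P Q I B A t rfl) e.μ) ≫ (M.rightUnitor (compObj P Q I B A t.sum)).hom =
      P.hom (M.rightUnitor (B t.length)).hom (tensCast Q I A (List.append_nil t)) ≫
        compι P Q I B A t rfl := by
    rw [Category.assoc, Category.assoc, h1, reassoc_of% h, P.comp_hom_assoc, Category.id_comp, hs]
  exact h2 _ (tensSplit_nil_right M hM A t)

section Triangles

variable {e : Interchange P I Q I} {MP : LaxMonoidal P I} {M : LaxMonoidal Q I}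
  (hM : ∀ X Y Z, IsIso (M.assoc X Y Z))

/-- The triangle equation in the middle. On a list of lists not all of length one the source is
initial, and otherwise the shuffle is known. -/
theorem comp_triangle (hP : P.PreservesCoproducts) (hQ : Q.PreservesCoproducts)
    (he : e.Normal MP M) (A B : Collection C) (j : ℕ) :
    compAssoc e MP M hM hP A (unitCollection I) B j ≫
        compHom P Q I (𝟙 A) (fun j => compLeftUnitorHom MP M hP B j) j =
      compHom P Q I (fun j => compRightUnitorHom MP M hP hQ A j) (𝟙 B) j := by
  refine compComp_hom_ext hP fun L h => ?_
  by_cases hL : ∀ i ∈ L.map List.length, i = 1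
  · have hL' : ∀ t ∈ L, t.length = 1 := fun t ht => hL _ (List.mem_map_of_mem ht)
    have h1 : L.flatten = L.map List.sum := by
      clear h hL
      induction L with
      | nil => rfl
      | cons t L ih =>
        obtain ⟨x, rfl⟩ := List.length_eq_one_iff.1 (hL' t List.mem_cons_self)
        rw [List.flatten_cons, List.map_cons, ← ih fun t ht => hL' t (List.mem_cons_of_mem _ ht)]
        simp
    have h2 : (L.map List.length).length = L.flatten.length := by rw [h1]; simp
    have h3 : L.flatten.length = (L.map List.sum).length := congrArg _ h1
    have h4 := shuffle_unit_left he hM hP B L hL' h1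
    have h5 := compι_compRightUnitorHom MP M hP hQ A (L.map List.length)
      List.length_flatten.symm h2
    have h6 := compι_compHom P Q I (fun j => compRightUnitorHom MP M hP hQ A j) (𝟙 B) L.flatten h
    rw [reassoc_of% (compCompι_compAssoc e MP M hM hP A (unitCollection I) B L h), compι_compHom,
      P.comp_hom_assoc, h4, compCompι, Category.assoc, h6, P.comp_hom_assoc, tensMap_id,
      Category.id_comp, h5, ← cast_compι P Q I A B h1 h3 (h1 ▸ h), P.comp_hom_assoc]
    have h7 : P.hom ((P.hom (castHom A h2) (tensUnit M (L.map List.length)) ≫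
          (MP.rightUnitor _).hom) ≫ castHom A h3) (𝟙 _ ≫ tensCast Q I B h1) =
        P.hom (P.hom (castHom A h2 ≫ castHom A h3) (tensUnit M (L.map List.length)))
          (tensCast Q I B h1) ≫ P.hom (MP.rightUnitor _).hom (𝟙 _) := by
      rw [Category.assoc, ← MP.rightUnitor_naturality, P.comp_hom_assoc, P.comp_hom,
        Category.comp_id, Category.id_comp, Category.comp_id]
    rw [h7, ← MP.triangle, Category.assoc, Category.assoc, MP.assoc_naturality_assoc,
      P.comp_hom_assoc, castHom_trans, Pi.id_apply]
  · exact hom_ext_of_isInitial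
      (hP.isInitial_left (hP.isInitial_right _ (isInitial_tens_unit hQ hL)) _) _ _

/-- The triangle equation on the right. Only lists of lists all of whose entries are one
contribute. -/
theorem comp_triangle_right (hP : P.PreservesCoproducts) (hQ : Q.PreservesCoproducts)
    (he : e.Normal MP M) (A B : Collection C) (j : ℕ) :
    compAssoc e MP M hM hP A B (unitCollection I) j ≫
        compHom P Q I (𝟙 A) (fun j => compRightUnitorHom MP M hP hQ B j) j =
      compRightUnitorHom MP M hP hQ (compObj P Q I A B) j := by
  refine compComp_hom_ext hP fun L h => ?_
  by_cases hL : ∀ i ∈ L.flatten, i = 1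
  · have hL' : L.map List.length = L.map List.sum := by
      refine List.map_congr_left fun t ht => ?_
      have h1 := List.eq_replicate_of_mem fun i hi => hL i (List.mem_flatten_of_mem ht hi)
      rw [h1]; simp
    have h1 : L.flatten.length = j := by
      rw [List.length_flatten, hL', ← List.sum_flatten, h]
    have h3 : (L.map List.length).length = (L.map List.sum).length := congrArg _ hL'
    have h4 := shuffle_unit_right he hM hP hQ B L hL'
    have h5 := compι_compRightUnitorHom MP M hP hQ (compObj P Q I A B) L.flatten h h1
    rw [reassoc_of% (compCompι_compAssoc e MP M hM hP A B (unitCollection I) L h), compι_compHom,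
      P.comp_hom_assoc, h4, compCompι, Category.assoc, h5, P.comp_hom_assoc, compι_castHom,
      Category.id_comp]
    have h6 : P.hom (compι P Q I A B (L.map List.length) (List.length_flatten.symm.trans h1))
          (tensUnit M L.flatten) =
        P.hom (P.hom (castHom A h3) (tensCast Q I B hL')) (tensUnit M L.flatten) ≫
          P.hom (compι P Q I A B (L.map List.sum) (List.sum_flatten.symm.trans h)) (𝟙 I) := by
      rw [P.comp_hom, Category.comp_id, cast_compι]
    rw [h6, Category.assoc, MP.rightUnitor_naturality, ← MP.triangle_right, Category.assoc,
      MP.assoc_naturality_assoc, P.comp_hom_assoc, Pi.id_apply]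
  · exact hom_ext_of_isInitial
      (hP.isInitial_right _ (isInitial_tens_unit hQ hL)) _ _

/-- The triangle equation on the left. Only lists of lists of length one contribute. -/
theorem comp_triangle_left (hP : P.PreservesCoproducts)
    (he : e.Normal MP M) (A B : Collection C) (j : ℕ) :
    compAssoc e MP M hM hP (unitCollection I) A B j ≫
        compLeftUnitorHom MP M hP (compObj P Q I A B) j =
      compHom P Q I (fun j => compLeftUnitorHom MP M hP A j) (𝟙 B) j := by
  refine compComp_hom_ext hP fun L h => ?_
  by_cases hL : (L.map List.length).length = 1
  · obtain ⟨t, rfl⟩ := List.length_eq_one_iff.1 ((List.length_map _).symm.trans hL)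
    have h1 : [t].flatten = t := List.append_nil t
    have h2 : t.sum = j := h1 ▸ h
    have h3 : t.length = [t].flatten.length := by rw [h1]
    have e1 : compCompι P Q I (unitCollection I) A B [t] h ≫
          compAssoc e MP M hM hP (unitCollection I) A B j ≫
          compLeftUnitorHom MP M hP (compObj P Q I A B) j =
        MP.assoc _ _ _ ≫ P.hom (unitTo I 1) (shuffle e M hM A B [t] ≫
          (M.rightUnitor (compObj P Q I A B t.sum)).hom) ≫ (MP.leftUnitor _).hom ≫
          castHom (compObj P Q I A B) h2 := by
      have h4 := compι_compLeftUnitorHom MP M hP (compObj P Q I A B) (i := t.sum) (j := j)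
        (List.sum_singleton.trans h2) h2
      have h5 : P.hom (castHom (unitCollection I) (rfl : 1 = 1)) (shuffle e M hM A B [t]) ≫
          P.hom (unitTo I 1) (M.rightUnitor (compObj P Q I A B t.sum)).hom =
          P.hom (unitTo I 1) (shuffle e M hM A B [t] ≫
            (M.rightUnitor (compObj P Q I A B t.sum)).hom) :=
        (P.comp_hom _ _ _ _).trans (congrArg (fun s => P.hom s _) (Category.id_comp _))
      rw [reassoc_of% (compCompι_compAssoc e MP M hM hP (unitCollection I) A B [t] h)]
      refine congrArg (MP.assoc _ _ _ ≫ ·) ?_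
      refine (congrArg (P.hom (castHom (unitCollection I) (rfl : 1 = 1))
        (shuffle e M hM A B [t]) ≫ ·) h4).trans ?_
      exact (Category.assoc _ _ _).symm.trans (congrArg (· ≫ (MP.leftUnitor _).hom ≫
        castHom (compObj P Q I A B) h2) h5)
    have e2 : compCompι P Q I (unitCollection I) A B [t] h ≫
          compHom P Q I (fun j => compLeftUnitorHom MP M hP A j) (𝟙 B) j =
        P.hom (P.hom (unitTo I 1) (M.rightUnitor (A t.length)).hom ≫ (MP.leftUnitor _).hom ≫
          castHom A h3) (𝟙 _) ≫ compι P Q I A B [t].flatten h := by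
      have h4 := compι_compLeftUnitorHom MP M hP A (i := t.length) (j := [t].flatten.length)
        (List.sum_singleton.trans h3) h3
      rw [compCompι, Category.assoc, compι_compHom, P.comp_hom_assoc, tensMap_id,
        Category.comp_id]
      exact congrArg (fun s => P.hom s (𝟙 _) ≫ _) h4
    have e3 := MP.assoc_hom_leftUnitor (unitTo I 1) (M.rightUnitor (A t.length)).hom
      (tensCast Q I B h1) (compι P Q I A B t rfl)
    have e4 := cast_compι P Q I A B h1 h3.symm h2
    rw [e1, e2, shuffle_singleton he hM A B t]
    refine (congrArg (MP.assoc _ _ _ ≫ ·) (Category.assoc _ _ _).symm).trans ?_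
    refine (Category.assoc _ _ _).symm.trans ?_
    refine (congrArg (· ≫ castHom (compObj P Q I A B) h2) e3).trans ?_
    rw [Category.assoc, compι_castHom, ← e4, P.comp_hom_assoc, Category.id_comp, Category.assoc,
      Category.assoc, castHom_trans, castHom_rfl, Category.comp_id]
  · exact hom_ext_of_isInitial
      (hP.isInitial_left (hP.isInitial_left (isInitial_unitCollection I hL) _) _) _ _

/-- The lax monoidal structure of the composition product. -/
noncomputable def compLaxMonoidal (he : e.Normal MP M) (hP : P.PreservesCoproducts)
    (hQ : Q.PreservesCoproducts) : LaxMonoidal (compProduct P Q I) (unitCollection I) where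
  assoc A B D := compAssoc e MP M hM hP A B D
  leftUnitor A := Pi.isoMk fun j => @asIso _ _ _ _ (compLeftUnitorHom MP M hP A j)
    (isIso_compLeftUnitorHom MP M hP A j)
  rightUnitor A := Pi.isoMk fun j => @asIso _ _ _ _ (compRightUnitorHom MP M hP hQ A j)
    (isIso_compRightUnitorHom MP M hP hQ A j)
  assoc_naturality f g h := funext fun j => compAssoc_naturality e MP M hM hP f g h j
  leftUnitor_naturality f := funext fun j => compLeftUnitorHom_naturality MP M hP f j
  rightUnitor_naturality f := funext fun j => compRightUnitorHom_naturality MP M hP hQ f j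
  pentagon A B D E := funext fun j => compAssoc_pentagon he hM hP A B D E j
  triangle A B := funext fun j => comp_triangle hM hP hQ he A B j
  triangle_left A B := funext fun j => comp_triangle_left hM hP he A B j
  triangle_right A B := funext fun j => comp_triangle_right hM hP hQ he A B j

end Triangles

end Units

/-! ### The iterated interchange -/

section TensInterchange

variable {Q R : Product C} {I : C}

/-- The iterated interchange, with its source written out as a tensor product of the objects
`A(j) ⊗_R B(j)`. -/
def tensInter (f : Interchange Q I R I) (A B : Collection C) : (l : List ℕ) →
    (tens Q I (fun j => R.obj (A j) (B j)) l ⟶ R.obj (tens Q I A l) (tens Q I B l))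
  | [] => f.δ
  | j :: l => Q.hom (𝟙 _) (tensInter f A B l) ≫ f.η (A j) (B j) (tens Q I A l) (tens Q I B l)

theorem tensInterchange_eq_tensInter (f : Interchange Q I R I) (A B : Collection C)
    (l : List ℕ) : tensInterchange f A B l = tensInter f A B l := by
  induction l with
  | nil => rfl
  | cons j l ih => exact congrArg (fun s => Q.hom (𝟙 _) s ≫ f.η _ _ _ _) ih

theorem tensInter_naturality (f : Interchange Q I R I) {A A' B B' : Collection C}
    (a : A ⟶ A') (b : B ⟶ B') (l : List ℕ) :
    tensMap Q I (A := fun j => R.obj (A j) (B j)) (B := fun j => R.obj (A' j) (B' j))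
        (fun j => R.hom (a j) (b j)) l ≫ tensInter f A' B' l =
      tensInter f A B l ≫ R.hom (tensMap Q I a l) (tensMap Q I b l) := by
  induction l with
  | nil =>
    dsimp only [tensMap, tensInter, tens]
    rw [Category.id_comp, R.hom_id, Category.comp_id]
  | cons j l ih =>
    dsimp only [tensMap, tensInter, tens] at ih ⊢
    rw [Q.comp_hom_assoc, Category.comp_id, ih, Category.assoc, ← f.η_naturality,
      Q.comp_hom_assoc, Category.id_comp]

variable {f : Interchange Q I R I} {MQ : LaxMonoidal Q I} {MR : LaxMonoidal R I}

/-- The iterated interchange over a concatenation. This is internal associativity, and the internal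
unit condition for the empty list. -/
theorem tensInter_split (hf : f.Normal MQ MR) (hM : ∀ X Y Z, IsIso (MQ.assoc X Y Z))
    (A B : Collection C) (l l' : List ℕ) :
    tensInter f A B (l ++ l') ≫ R.hom (tensSplit MQ hM A l l') (tensSplit MQ hM B l l') =
      tensSplit MQ hM (fun j => R.obj (A j) (B j)) l l' ≫
        Q.hom (tensInter f A B l) (tensInter f A B l') ≫ f.η _ _ _ _ := by
  induction l with
  | nil =>
    dsimp only [tensInter, tens, tensSplit, List.nil_append]
    rw [← cancel_mono (R.hom (MQ.leftUnitor (tens Q I A l')).hom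
      (MQ.leftUnitor (tens Q I B l')).hom)]
    simp only [Category.assoc]
    rw [hf.η_unit_left, Q.comp_hom_assoc, R.comp_hom, Iso.inv_hom_id, Iso.inv_hom_id, R.hom_id,
      hf.δ_eq, Iso.inv_hom_id, Category.comp_id, MQ.leftUnitor_naturality,
      Iso.inv_hom_id_assoc]
  | cons j l ih =>
    dsimp only [tensInter, tens, tensSplit, List.cons_append] at ih ⊢
    have := hM (A j) (tens Q I A l) (tens Q I A l')
    have := hM (B j) (tens Q I B l) (tens Q I B l')
    rw [← cancel_mono (R.hom (MQ.assoc (A j) (tens Q I A l) (tens Q I A l'))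
      (MQ.assoc (B j) (tens Q I B l) (tens Q I B l')))]
    have h1 := hf.internal_assoc (A j) (B j) (tens Q I A l) (tens Q I B l) (tens Q I A l')
      (tens Q I B l')
    have h2 : Q.hom (Q.hom (𝟙 (R.obj (A j) (B j))) (tensInter f A B l) ≫ f.η _ _ _ _)
        (tensInter f A B l') =
        Q.hom (Q.hom (𝟙 _) (tensInter f A B l)) (tensInter f A B l') ≫
          Q.hom (f.η _ _ _ _) (𝟙 _) := by
      rw [Q.comp_hom, Category.comp_id]
    have h3 := f.η_naturality (𝟙 (A j)) (𝟙 (B j)) (tensSplit MQ hM A l l')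
      (tensSplit MQ hM B l l')
    rw [h2]
    simp only [Category.assoc]
    rw [h1, MQ.assoc_naturality_assoc, IsIso.inv_hom_id_assoc, R.comp_hom, Category.assoc,
      Category.assoc, IsIso.inv_hom_id, IsIso.inv_hom_id, Category.comp_id, Category.comp_id, ← h3,
      Q.comp_hom_assoc, ih, R.hom_id, Q.comp_hom_assoc, Q.comp_hom_assoc]
    simp only [Category.comp_id, Category.assoc]

/-- The external unit conditions for the iterated interchange. -/
theorem tensInter_const_right (hf : f.Normal MQ MR) (A : Collection C) (l : List ℕ) :
    tensInter f A (constCollection I) l ≫ R.hom (𝟙 _) (tensConst MQ l) ≫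
        (MR.rightUnitor _).hom =
      tensMap Q I (A := fun j => R.obj (A j) I) (fun j => (MR.rightUnitor (A j)).hom) l := by
  induction l with
  | nil =>
    dsimp only [tensInter, tens, tensConst, tensMap]
    rw [R.hom_id, Category.id_comp, MR.rightUnitor_unit, hf.δ_eq, Iso.inv_hom_id]
  | cons j l ih =>
    dsimp only [tensInter, tens, tensConst, tensMap, constCollection] at ih ⊢
    have h1 : R.hom (𝟙 (Q.obj (A j) (tens Q I A l)))
        (Q.hom (𝟙 I) (tensConst MQ l) ≫ (MQ.leftUnitor I).hom) =
        R.hom (Q.hom (𝟙 _) (𝟙 _)) (Q.hom (𝟙 I) (tensConst MQ l)) ≫ R.hom (𝟙 _) f.μ := by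
      rw [Q.hom_id, R.comp_hom, Category.comp_id, hf.μ_eq]
    rw [h1]
    simp only [Category.assoc]
    refine (congrArg (Q.hom (𝟙 (R.obj (A j) I)) (tensInter f A (fun _ => I) l) ≫ ·)
      (f.η_naturality_assoc (𝟙 (A j)) (𝟙 I) (𝟙 (tens Q I A l)) (tensConst MQ l) _).symm).trans ?_
    rw [hf.external_unit_right]
    refine (Q.comp_hom_assoc _ _ _ _ _).trans ((Q.comp_hom _ _ _ _).trans ?_)
    rw [R.hom_id, Category.id_comp, Category.id_comp]
    exact congrArg (Q.hom _) ((Category.assoc _ _ _).trans ih)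

theorem tensInter_const_left (hf : f.Normal MQ MR) (A : Collection C) (l : List ℕ) :
    tensInter f (constCollection I) A l ≫ R.hom (tensConst MQ l) (𝟙 _) ≫
        (MR.leftUnitor _).hom =
      tensMap Q I (A := fun j => R.obj I (A j)) (fun j => (MR.leftUnitor (A j)).hom) l := by
  induction l with
  | nil =>
    dsimp only [tensInter, tens, tensConst, tensMap]
    rw [R.hom_id, Category.id_comp, hf.δ_eq, Iso.inv_hom_id]
  | cons j l ih =>
    dsimp only [tensInter, tens, tensConst, tensMap, constCollection] at ih ⊢
    have h1 : R.hom (Q.hom (𝟙 I) (tensConst MQ l) ≫ (MQ.leftUnitor I).hom)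
        (𝟙 (Q.obj (A j) (tens Q I A l))) =
        R.hom (Q.hom (𝟙 I) (tensConst MQ l)) (Q.hom (𝟙 _) (𝟙 _)) ≫ R.hom f.μ (𝟙 _) := by
      rw [Q.hom_id, R.comp_hom, Category.comp_id, hf.μ_eq]
    rw [h1]
    simp only [Category.assoc]
    refine (congrArg (Q.hom (𝟙 (R.obj I (A j))) (tensInter f (fun _ => I) A l) ≫ ·)
      (f.η_naturality_assoc (𝟙 I) (𝟙 (A j)) (tensConst MQ l) (𝟙 (tens Q I A l)) _).symm).trans ?_
    rw [hf.external_unit_left]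
    refine (Q.comp_hom_assoc _ _ _ _ _).trans ((Q.comp_hom _ _ _ _).trans ?_)
    rw [R.hom_id, Category.id_comp, Category.id_comp]
    exact congrArg (Q.hom _) ((Category.assoc _ _ _).trans ih)

/-- The external associativity condition for the iterated interchange. -/
theorem tensInter_assoc (hf : f.Normal MQ MR) (A B D : Collection C) (l : List ℕ) :
    tensInter f (fun j => R.obj (A j) (B j)) D l ≫ R.hom (tensInter f A B l) (𝟙 _) ≫
        MR.assoc _ _ _ =
      tensMap Q I (A := fun j => R.obj (R.obj (A j) (B j)) (D j))
          (B := fun j => R.obj (A j) (R.obj (B j) (D j)))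
          (fun j => MR.assoc (A j) (B j) (D j)) l ≫
        tensInter f A (fun j => R.obj (B j) (D j)) l ≫
        R.hom (𝟙 _) (tensInter f B D l) := by
  induction l with
  | nil =>
    dsimp only [tensInter, tens, tensMap]
    rw [Category.id_comp, ← cancel_mono (R.hom (𝟙 I) (MR.leftUnitor I).hom)]
    simp only [Category.assoc]
    rw [MR.triangle, R.comp_hom, R.comp_hom, MR.rightUnitor_unit, hf.δ_eq, Iso.inv_hom_id,
      Category.comp_id]
  | cons j l ih =>
    dsimp only [tensInter, tens, tensMap] at ih ⊢
    have h1 : R.hom (Q.hom (𝟙 (R.obj (A j) (B j))) (tensInter f A B l) ≫ f.η _ _ _ _)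
        (𝟙 (Q.obj (D j) (tens Q I D l))) =
        R.hom (Q.hom (𝟙 _) (tensInter f A B l)) (Q.hom (𝟙 _) (𝟙 _)) ≫
          R.hom (f.η _ _ _ _) (𝟙 _) := by
      rw [Q.hom_id, R.comp_hom, Category.comp_id]
    have h2 : R.hom (𝟙 (Q.obj (A j) (tens Q I A l)))
        (Q.hom (𝟙 (R.obj (B j) (D j))) (tensInter f B D l) ≫ f.η _ _ _ _) =
        R.hom (Q.hom (𝟙 _) (𝟙 _)) (Q.hom (𝟙 _) (tensInter f B D l)) ≫
          R.hom (𝟙 _) (f.η _ _ _ _) := by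
      rw [Q.hom_id, R.comp_hom, Category.comp_id]
    have h3 := hf.external_assoc (A j) (B j) (D j) (tens Q I A l) (tens Q I B l) (tens Q I D l)
    rw [h1, h2]
    simp only [Category.assoc]
    rw [← f.η_naturality_assoc, ← f.η_naturality_assoc, h3, Q.comp_hom_assoc, Q.comp_hom_assoc,
      Q.comp_hom_assoc, Q.comp_hom_assoc, Category.assoc, Category.assoc, ih]
    simp only [R.hom_id, Category.id_comp, Category.comp_id, Category.assoc]

/-- The interchange of four copies of the unit is the identity, up to canonical isomorphisms. This is
the case of the empty list in several inductions. -/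
theorem Interchange.Normal.η_unit_hexagon {S T : Product C} {e : Interchange S I T I}
    {M : LaxMonoidal S I} {N : LaxMonoidal T I} (he : e.Normal M N) :
    S.hom (N.leftUnitor I).inv (N.leftUnitor I).inv ≫ e.η I I I I ≫
      T.hom (M.leftUnitor I).hom (M.leftUnitor I).hom =
      (M.leftUnitor I).hom ≫ (N.leftUnitor I).inv := by
  rw [he.η_unit_left, S.comp_hom_assoc, Iso.inv_hom_id, Category.comp_id, M.leftUnitor_naturality]

/-- The iterated interchange inherits the giant hexagon. -/
theorem tensInter_hexagon {R' : Product C} {f' : Interchange Q I R' I}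
    {g : Interchange R I R' I} {MR' : LaxMonoidal R' I} (hf : f.Normal MQ MR)
    (hf' : f'.Normal MQ MR') (hg : g.Normal MR MR') (h : Hexagon f g f')
    (A A' B B' : Collection C) (l : List ℕ) :
    tensMap Q I (A := fun j => R.obj (R'.obj (A j) (A' j)) (R'.obj (B j) (B' j)))
          (B := fun j => R'.obj (R.obj (A j) (B j)) (R.obj (A' j) (B' j)))
          (fun j => g.η (A j) (A' j) (B j) (B' j)) l ≫
        tensInter f' (fun j => R.obj (A j) (B j)) (fun j => R.obj (A' j) (B' j)) l ≫
        R'.hom (tensInter f A B l) (tensInter f A' B' l) =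
      tensInter f (fun j => R'.obj (A j) (A' j)) (fun j => R'.obj (B j) (B' j)) l ≫
        R.hom (tensInter f' A A' l) (tensInter f' B B' l) ≫ g.η _ _ _ _ := by
  induction l with
  | nil =>
    dsimp only [tensInter, tens, tensMap]
    rw [← cancel_mono (R'.hom (MR.leftUnitor I).hom (MR.leftUnitor I).hom)]
    simp only [Category.assoc]
    rw [hf'.δ_eq, hg.η_unit_hexagon, hf.δ_eq, R'.comp_hom, Iso.inv_hom_id, R'.hom_id,
      Iso.inv_hom_id_assoc, Category.id_comp, Category.comp_id]
  | cons j l ih =>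
    dsimp only [tensInter, tens, tensMap] at ih ⊢
    have h1 := h (A j) (A' j) (B j) (B' j) (tens Q I A l) (tens Q I A' l) (tens Q I B l)
      (tens Q I B' l)
    simp only [Category.assoc]
    rw [R'.hom_comp, R.hom_comp, ← f'.η_naturality_assoc, Category.assoc, ← f.η_naturality_assoc,
      ← h1, Q.comp_hom_assoc, Q.comp_hom_assoc, Q.comp_hom_assoc, Q.comp_hom_assoc]
    simp only [Category.assoc]
    rw [ih]
    simp only [R.hom_id, R'.hom_id, Category.id_comp, Category.comp_id]

/-- Restricted to the units of the composition product, the iterated interchange is the comparison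
map `δ`. -/
theorem tensInter_unit [HasCoproducts.{0} C] (hf : f.Normal MQ MR)
    (d : ∀ j, unitCollection I j ⟶ R.obj (unitCollection I j) (unitCollection I j))
    (hd : ∀ j, d j ≫ R.hom (unitTo I j) (unitTo I j) = unitTo I j ≫ (MR.leftUnitor I).inv)
    (l : List ℕ) :
    tensMap Q I (B := fun j => R.obj (unitCollection I j) (unitCollection I j)) d l ≫
        tensInter f (unitCollection I) (unitCollection I) l ≫
        R.hom (tensUnit MQ l) (tensUnit MQ l) =
      tensUnit MQ l ≫ (MR.leftUnitor I).inv := by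
  induction l with
  | nil =>
    dsimp only [tensInter, tens, tensUnit, tensMap]
    rw [R.hom_id, hf.δ_eq, Category.id_comp, Category.id_comp, Category.comp_id]
  | cons j l ih =>
    dsimp only [tensInter, tens, tensUnit, tensMap] at ih ⊢
    simp only [Category.assoc]
    rw [R.hom_comp, ← f.η_naturality_assoc, Q.comp_hom_assoc, Q.comp_hom_assoc, Category.comp_id,
      Category.assoc, ih, hd, Q.hom_comp, Category.assoc, hf.η_unit_hexagon]

end TensInterchange

/-! ### The interchange of the composition product with a levelwise product -/

section CompInterchange

variable [HasCoproducts.{0} C] {P Q R : Product C} {I : C}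

/-- The interchange from the composition product to a levelwise product. -/
noncomputable def compInter (g : Interchange P I R I) (f : Interchange Q I R I)
    (A B D E : Collection C) (j : ℕ) :
    compObj P Q I (fun j => R.obj (A j) (B j)) (fun j => R.obj (D j) (E j)) j ⟶
      R.obj (compObj P Q I A D j) (compObj P Q I B E j) :=
  Sigma.desc fun l => P.hom (𝟙 _) (tensInter f D E l.1) ≫
    g.η (A l.1.length) (B l.1.length) (tens Q I D l.1) (tens Q I E l.1) ≫
    R.hom (compι P Q I A D l.1 l.2) (compι P Q I B E l.1 l.2)

theorem compι_compInter (g : Interchange P I R I) (f : Interchange Q I R I)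
    (A B D E : Collection C) {j : ℕ} (l : List ℕ) (h : l.sum = j) :
    compι P Q I (fun j => R.obj (A j) (B j)) (fun j => R.obj (D j) (E j)) l h ≫
        compInter g f A B D E j =
      P.hom (𝟙 _) (tensInter f D E l) ≫
        g.η (A l.length) (B l.length) (tens Q I D l) (tens Q I E l) ≫
        R.hom (compι P Q I A D l h) (compι P Q I B E l h) :=
  Sigma.ι_desc (fun l : {l : List ℕ // l.sum = j} => P.hom (𝟙 _) (tensInter f D E l.1) ≫
    g.η (A l.1.length) (B l.1.length) (tens Q I D l.1) (tens Q I E l.1) ≫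
    R.hom (compι P Q I A D l.1 l.2) (compι P Q I B E l.1 l.2)) ⟨l, h⟩

theorem compInter_naturality (g : Interchange P I R I) (f : Interchange Q I R I)
    {A A' B B' D D' E E' : Collection C} (a : A ⟶ A') (b : B ⟶ B') (d : D ⟶ D') (e : E ⟶ E')
    (j : ℕ) :
    compHom P Q I (A := fun j => R.obj (A j) (B j)) (A' := fun j => R.obj (A' j) (B' j))
          (B := fun j => R.obj (D j) (E j)) (B' := fun j => R.obj (D' j) (E' j))
          (fun j => R.hom (a j) (b j)) (fun j => R.hom (d j) (e j)) j ≫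
        compInter g f A' B' D' E' j =
      compInter g f A B D E j ≫ R.hom (compHom P Q I a d j) (compHom P Q I b e j) := by
  refine compObj_hom_ext P Q I fun l h => ?_
  have h1 := compι_compHom P Q I (A := fun j => R.obj (A j) (B j))
    (A' := fun j => R.obj (A' j) (B' j)) (B := fun j => R.obj (D j) (E j))
    (B' := fun j => R.obj (D' j) (E' j)) (fun j => R.hom (a j) (b j))
    (fun j => R.hom (d j) (e j)) l h
  rw [reassoc_of% h1, compι_compInter, reassoc_of% (compι_compInter g f A B D E l h), R.comp_hom,
    compι_compHom, compι_compHom, P.comp_hom_assoc, tensInter_naturality, R.hom_comp,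
    ← g.η_naturality_assoc, P.comp_hom_assoc, Category.comp_id, Category.id_comp]

/-- The comparison map `δ` of the composition product with a levelwise product: the canonical
isomorphism `I ≅ I ⊗ I` in degree one, and an isomorphism of initial objects in all other
degrees. -/
theorem exists_compUnit_comparison (N : LaxMonoidal R I) (hR : R.PreservesCoproducts) :
    ∃ d : ∀ j, unitCollection I j ⟶ R.obj (unitCollection I j) (unitCollection I j),
      (∀ j, IsIso (d j)) ∧
        ∀ j, d j ≫ R.hom (unitTo I j) (unitTo I j) = unitTo I j ≫ (N.leftUnitor I).inv := by
  suffices H : ∀ j, ∃ d : unitCollection I j ⟶ R.obj (unitCollection I j) (unitCollection I j),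
      IsIso d ∧ d ≫ R.hom (unitTo I j) (unitTo I j) = unitTo I j ≫ (N.leftUnitor I).inv by
    choose d hd hd' using H
    exact ⟨d, hd, hd'⟩
  intro j
  by_cases hj : j = 1
  · subst hj
    exact ⟨unitTo I 1 ≫ (N.leftUnitor I).inv ≫ inv (R.hom (unitTo I 1) (unitTo I 1)),
      inferInstance, by simp⟩
  · have h1 := isInitial_unitCollection I hj
    exact ⟨(h1.some.uniqueUpToIso (hR.isInitial_left h1 _).some).hom, inferInstance,
      hom_ext_of_isInitial h1 _ _⟩

/-- The comparison map `μ` of the composition product with a levelwise product: on each summand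
the canonical isomorphism of a tensor product of copies of `I` with `I`. -/
noncomputable def compMu (MP : LaxMonoidal P I) (MQ : LaxMonoidal Q I) (j : ℕ) :
    compObj P Q I (constCollection I) (constCollection I) j ⟶ I :=
  Sigma.desc fun l => P.hom (𝟙 I) (tensConst MQ l.1) ≫ (MP.leftUnitor I).hom

theorem compι_compMu (MP : LaxMonoidal P I) (MQ : LaxMonoidal Q I) {j : ℕ} (l : List ℕ)
    (h : l.sum = j) :
    compι P Q I (constCollection I) (constCollection I) l h ≫ compMu MP MQ j =
      P.hom (𝟙 I) (tensConst MQ l) ≫ (MP.leftUnitor I).hom :=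
  Sigma.ι_desc (fun l : {l : List ℕ // l.sum = j} =>
    P.hom (𝟙 I) (tensConst MQ l.1) ≫ (MP.leftUnitor I).hom) ⟨l, h⟩

variable {e : Interchange P I Q I} {f : Interchange Q I R I} {g : Interchange P I R I}
  {MP : LaxMonoidal P I} {MQ : LaxMonoidal Q I} {MR : LaxMonoidal R I}

/-- The internal unit condition on the right. -/
theorem compInter_unit_right (hP : P.PreservesCoproducts) (hQ : Q.PreservesCoproducts)
    (hf : f.Normal MQ MR) (hg : g.Normal MP MR)
    (d : ∀ j, unitCollection I j ⟶ R.obj (unitCollection I j) (unitCollection I j))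
    (hd : ∀ j, d j ≫ R.hom (unitTo I j) (unitTo I j) = unitTo I j ≫ (MR.leftUnitor I).inv)
    (A B : Collection C) (j : ℕ) :
    compHom P Q I (𝟙 (fun j => R.obj (A j) (B j) : Collection C))
          (B' := fun j => R.obj (unitCollection I j) (unitCollection I j)) d j ≫
        compInter g f A B (unitCollection I) (unitCollection I) j ≫
        R.hom (compRightUnitorHom MP MQ hP hQ A j) (compRightUnitorHom MP MQ hP hQ B j) =
      compRightUnitorHom MP MQ hP hQ (fun j => R.obj (A j) (B j)) j := by
  refine compObj_unit_right_hom_ext hP hQ fun l h hl => ?_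
  have h1 := compι_compHom P Q I (𝟙 (fun j => R.obj (A j) (B j) : Collection C))
    (B' := fun j => R.obj (unitCollection I j) (unitCollection I j)) d l h
  rw [reassoc_of% h1,
    reassoc_of% (compι_compInter g f A B (unitCollection I) (unitCollection I) l h), R.comp_hom,
    compι_compRightUnitorHom MP MQ hP hQ A l h hl, compι_compRightUnitorHom MP MQ hP hQ B l h hl,
    compι_compRightUnitorHom MP MQ hP hQ _ l h hl, R.hom_comp, ← g.η_naturality_assoc,
    hg.η_unit_right, P.comp_hom_assoc, P.comp_hom_assoc, P.comp_hom_assoc, hom_castHom]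
  simp only [Category.assoc]
  rw [reassoc_of% (tensInter_unit hf d hd l), Iso.inv_hom_id, Pi.id_apply]
  simp only [Category.id_comp, Category.comp_id]

/-- The internal unit condition on the left. -/
theorem compInter_unit_left (hP : P.PreservesCoproducts)
    (hf : f.Normal MQ MR) (hg : g.Normal MP MR)
    (d : ∀ j, unitCollection I j ⟶ R.obj (unitCollection I j) (unitCollection I j))
    (hd : ∀ j, d j ≫ R.hom (unitTo I j) (unitTo I j) = unitTo I j ≫ (MR.leftUnitor I).inv)
    (A B : Collection C) (j : ℕ) :
    compHom P Q I (A' := fun j => R.obj (unitCollection I j) (unitCollection I j)) d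
          (𝟙 (fun j => R.obj (A j) (B j) : Collection C)) j ≫
        compInter g f (unitCollection I) (unitCollection I) A B j ≫
        R.hom (compLeftUnitorHom MP MQ hP A j) (compLeftUnitorHom MP MQ hP B j) =
      compLeftUnitorHom MP MQ hP (fun j => R.obj (A j) (B j)) j := by
  refine compObj_unit_left_hom_ext hP ?_
  have h1 := compι_compHom P Q I (A' := fun j => R.obj (unitCollection I j) (unitCollection I j)) d
    (𝟙 (fun j => R.obj (A j) (B j) : Collection C)) [j] List.sum_singleton
  have h2 := hf.internal_unit_right (A j) (B j)
  have h3 (A : Collection C) := compι_compLeftUnitorHom MP MQ hP A (List.sum_singleton (x := j)) rfl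
  rw [reassoc_of% h1, reassoc_of% (compι_compInter g f (unitCollection I) (unitCollection I) A B
      [j] List.sum_singleton), R.comp_hom, h3, h3, h3, tensMap_id]
  dsimp only [tens, List.length, tensInter, castHom_rfl, Nat.reduceAdd]
  rw [R.hom_comp, ← g.η_naturality_assoc, Category.comp_id, Category.comp_id, Category.comp_id,
    hg.η_unit_left, P.comp_hom_assoc, P.comp_hom_assoc, P.comp_hom_assoc]
  simp only [Category.id_comp, Category.comp_id, Category.assoc]
  rw [h2, reassoc_of% (hd 1), Iso.inv_hom_id, Category.comp_id]

/-- The external unit condition on the right. -/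
theorem compInter_const_right (hf : f.Normal MQ MR) (hg : g.Normal MP MR)
    (A B : Collection C) (j : ℕ) :
    compInter g f A (constCollection I) B (constCollection I) j ≫
        R.hom (𝟙 (compObj P Q I A B j)) (compMu MP MQ j) ≫ (MR.rightUnitor _).hom =
      compHom P Q I (A := fun j => R.obj (A j) I) (B := fun j => R.obj (B j) I)
        (fun j => (MR.rightUnitor (A j)).hom) (fun j => (MR.rightUnitor (B j)).hom) j := by
  refine compObj_hom_ext P Q I fun l h => ?_
  have h1 := compι_compInter g f A (constCollection I) B (constCollection I) l h
  have h2 := compι_compHom P Q I (A := fun j => R.obj (A j) I) (B := fun j => R.obj (B j) I)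
        (fun j => (MR.rightUnitor (A j)).hom) (fun j => (MR.rightUnitor (B j)).hom) l h
  have h3 := tensInter_const_right hf B l
  have h4 : R.hom (compι P Q I A B l h) (P.hom (𝟙 I) (tensConst MQ l) ≫ (MP.leftUnitor I).hom) ≫
        (MR.rightUnitor _).hom =
      R.hom (P.hom (𝟙 _) (𝟙 _)) (P.hom (𝟙 I) (tensConst MQ l)) ≫ R.hom (𝟙 _) g.μ ≫
        (MR.rightUnitor _).hom ≫ compι P Q I A B l h := by
    rw [← MR.rightUnitor_naturality, P.hom_id, R.comp_hom_assoc, R.comp_hom_assoc, hg.μ_eq,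
      Category.id_comp, Category.id_comp, Category.comp_id]
  refine ((reassoc_of% h1) _).trans (Eq.trans ?_ h2.symm)
  have h5 := g.η_naturality_assoc (𝟙 (A l.length)) (𝟙 I) (𝟙 (tens Q I B l)) (tensConst MQ l)
    (R.hom (𝟙 _) g.μ ≫ (MR.rightUnitor _).hom ≫ compι P Q I A B l h)
  rw [R.comp_hom_assoc, Category.comp_id, compι_compMu]
  refine (congrArg (fun s => P.hom (𝟙 _) (tensInter f B (constCollection I) l) ≫ g.η _ _ _ _ ≫ s)
    h4).trans ?_
  refine (congrArg (P.hom (𝟙 _) (tensInter f B (constCollection I) l) ≫ ·) h5.symm).trans ?_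
  rw [reassoc_of% (hg.external_unit_right (A l.length) (tens Q I B l))]
  refine (P.comp_hom_assoc _ _ _ _ _).trans ((P.comp_hom_assoc _ _ _ _ _).trans ?_)
  rw [R.hom_id, Category.id_comp, Category.id_comp]
  exact congrArg (fun s => P.hom _ s ≫ _) ((Category.assoc _ _ _).trans h3)

/-- The external unit condition on the left. -/
theorem compInter_const_left (hf : f.Normal MQ MR) (hg : g.Normal MP MR)
    (A B : Collection C) (j : ℕ) :
    compInter g f (constCollection I) A (constCollection I) B j ≫
        R.hom (compMu MP MQ j) (𝟙 (compObj P Q I A B j)) ≫ (MR.leftUnitor _).hom =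
      compHom P Q I (A := fun j => R.obj I (A j)) (B := fun j => R.obj I (B j))
        (fun j => (MR.leftUnitor (A j)).hom) (fun j => (MR.leftUnitor (B j)).hom) j := by
  refine compObj_hom_ext P Q I fun l h => ?_
  have h1 := compι_compInter g f (constCollection I) A (constCollection I) B l h
  have h2 := compι_compHom P Q I (A := fun j => R.obj I (A j)) (B := fun j => R.obj I (B j))
        (fun j => (MR.leftUnitor (A j)).hom) (fun j => (MR.leftUnitor (B j)).hom) l h
  have h3 := tensInter_const_left hf B l
  have h4 : R.hom (P.hom (𝟙 I) (tensConst MQ l) ≫ (MP.leftUnitor I).hom) (compι P Q I A B l h) ≫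
        (MR.leftUnitor _).hom =
      R.hom (P.hom (𝟙 I) (tensConst MQ l)) (P.hom (𝟙 _) (𝟙 _)) ≫ R.hom g.μ (𝟙 _) ≫
        (MR.leftUnitor _).hom ≫ compι P Q I A B l h := by
    rw [← MR.leftUnitor_naturality, P.hom_id, R.comp_hom_assoc, R.comp_hom_assoc, hg.μ_eq,
      Category.id_comp, Category.id_comp, Category.comp_id]
  refine ((reassoc_of% h1) _).trans (Eq.trans ?_ h2.symm)
  have h5 := g.η_naturality_assoc (𝟙 I) (𝟙 (A l.length)) (tensConst MQ l) (𝟙 (tens Q I B l))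
    (R.hom g.μ (𝟙 _) ≫ (MR.leftUnitor _).hom ≫ compι P Q I A B l h)
  rw [R.comp_hom_assoc, Category.comp_id, compι_compMu]
  refine (congrArg (fun s => P.hom (𝟙 _) (tensInter f (constCollection I) B l) ≫ g.η _ _ _ _ ≫ s)
    h4).trans ?_
  refine (congrArg (P.hom (𝟙 _) (tensInter f (constCollection I) B l) ≫ ·) h5.symm).trans ?_
  rw [reassoc_of% (hg.external_unit_left (A l.length) (tens Q I B l))]
  refine (P.comp_hom_assoc _ _ _ _ _).trans ((P.comp_hom_assoc _ _ _ _ _).trans ?_)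
  rw [R.hom_id, Category.id_comp, Category.id_comp]
  exact congrArg (fun s => P.hom _ s ≫ _) ((Category.assoc _ _ _).trans h3)

/-- The shuffle commutes with the iterated interchanges. This rests on the giant hexagon for
`P`, `Q` and `R`. -/
theorem shuffle_compInter (he : e.Normal MP MQ) (hf : f.Normal MQ MR) (hg : g.Normal MP MR)
    (hM : ∀ X Y Z, IsIso (MQ.assoc X Y Z)) (h : Hexagon e f g) (A B D E : Collection C)
    (L : List (List ℕ)) :
    shuffle e MQ hM (fun j => R.obj (A j) (B j)) (fun j => R.obj (D j) (E j)) L ≫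
        tensMap Q I (B := fun j => R.obj (compObj P Q I A D j) (compObj P Q I B E j))
          (fun j => compInter g f A B D E j) (L.map List.sum) ≫
        tensInter f (compObj P Q I A D) (compObj P Q I B E) (L.map List.sum) =
      P.hom (tensInter f A B (L.map List.length)) (tensInter f D E L.flatten) ≫ g.η _ _ _ _ ≫
        R.hom (shuffle e MQ hM A D L) (shuffle e MQ hM B E L) := by
  induction L with
  | nil =>
    dsimp only [shuffle, tensMap, List.map, tensInter, tens, List.flatten_nil]
    rw [Category.id_comp, hf.δ_eq, he.μ_eq, hg.η_unit_hexagon]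
  | cons t L ih =>
    have h1 := compι_compInter g f A B D E t rfl
    have h2 := tensInter_split hf hM D E t L.flatten
    have h3 := h (A t.length) (B t.length) (tens Q I A (L.map List.length))
      (tens Q I B (L.map List.length)) (tens Q I D t) (tens Q I E t) (tens Q I D L.flatten)
      (tens Q I E L.flatten)
    dsimp only [shuffle, tensMap, List.map, tensInter, tens, List.flatten_cons]
    have h4 : P.hom (Q.hom (𝟙 (R.obj (A t.length) (B t.length)))
          (tensInter f A B (L.map List.length)) ≫ f.η _ _ _ _) (tensInter f D E (t ++ L.flatten)) ≫
        P.hom (𝟙 _) (R.hom (tensSplit MQ hM D t L.flatten) (tensSplit MQ hM E t L.flatten)) =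
      P.hom (𝟙 _) (tensSplit MQ hM (fun j => R.obj (D j) (E j)) t L.flatten) ≫
        P.hom (Q.hom (𝟙 _) (tensInter f A B (L.map List.length)))
          (Q.hom (tensInter f D E t) (tensInter f D E L.flatten)) ≫
        P.hom (f.η _ _ _ _) (f.η _ _ _ _) := by
      rw [P.comp_hom, P.comp_hom, P.comp_hom, h2, Category.comp_id, Category.id_comp]
    rw [R.hom_comp, ← g.η_naturality_assoc, R.hom_id, reassoc_of% h4, R.hom_comp, reassoc_of% h3]
    simp only [Category.assoc, Q.comp_hom_assoc, Category.comp_id]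
    rw [e.η_naturality_assoc, ← f.η_naturality, Q.comp_hom_assoc, Q.comp_hom_assoc,
      h1, ih]
    simp only [Category.assoc]

/-- Internal associativity, on the summand of a list of lists: the associators of `P` are treated by
internal associativity for `P`, the shuffles by `shuffle_compInter`. -/
theorem compInter_internal_assoc (he : e.Normal MP MQ) (hf : f.Normal MQ MR)
    (hg : g.Normal MP MR) (hM : ∀ X Y Z, IsIso (MQ.assoc X Y Z)) (h : Hexagon e f g)
    (hP : P.PreservesCoproducts) (A B X Y Z W : Collection C) (j : ℕ) :
    compHom P Q I (A' := fun j => R.obj (compObj P Q I A X j) (compObj P Q I B Y j))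
          (fun j => compInter g f A B X Y j) (𝟙 (fun j => R.obj (Z j) (W j) : Collection C)) j ≫
        compInter g f (compObj P Q I A X) (compObj P Q I B Y) Z W j ≫
        R.hom (compAssoc e MP MQ hM hP A X Z j) (compAssoc e MP MQ hM hP B Y W j) =
      compAssoc e MP MQ hM hP (fun j => R.obj (A j) (B j)) (fun j => R.obj (X j) (Y j))
          (fun j => R.obj (Z j) (W j)) j ≫
        compHom P Q I (B' := fun j => R.obj (compObj P Q I X Z j) (compObj P Q I Y W j))
          (𝟙 (fun j => R.obj (A j) (B j) : Collection C)) (fun j => compInter g f X Y Z W j) j ≫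
        compInter g f A B (compObj P Q I X Z) (compObj P Q I Y W) j := by
  refine compComp_hom_ext hP fun L hL => ?_
  have c₁ := compCompι_compAssoc e MP MQ hM hP (fun j => R.obj (A j) (B j))
    (fun j => R.obj (X j) (Y j)) (fun j => R.obj (Z j) (W j)) L hL
  have c₂ := compCompι_compAssoc e MP MQ hM hP A X Z L hL
  have c₃ := compCompι_compAssoc e MP MQ hM hP B Y W L hL
  have h₁ := compι_compHom P Q I (A' := fun j => R.obj (compObj P Q I A X j) (compObj P Q I B Y j))
    (fun j => compInter g f A B X Y j) (𝟙 (fun j => R.obj (Z j) (W j) : Collection C)) L.flatten hL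
  have h₂ := compι_compHom P Q I
    (B' := fun j => R.obj (compObj P Q I X Z j) (compObj P Q I Y W j))
    (𝟙 (fun j => R.obj (A j) (B j) : Collection C)) (fun j => compInter g f X Y Z W j)
    (L.map List.sum) (List.sum_flatten.symm.trans hL)
  have h₃ := compι_compInter g f A B X Y (L.map List.length) List.length_flatten.symm
  have h₄ := compι_compInter g f (compObj P Q I A X) (compObj P Q I B Y) Z W L.flatten hL
  have h₅ := compι_compInter g f A B (compObj P Q I X Z) (compObj P Q I Y W) (L.map List.sum)
    (List.sum_flatten.symm.trans hL)
  have h₆ := hg.internal_assoc (A (L.map List.length).length) (B (L.map List.length).length)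
    (tens Q I X (L.map List.length)) (tens Q I Y (L.map List.length)) (tens Q I Z L.flatten)
    (tens Q I W L.flatten)
  have h₇ := shuffle_compInter he hf hg hM h X Y Z W L
  have lhs : compCompι P Q I (fun j => R.obj (A j) (B j)) (fun j => R.obj (X j) (Y j))
          (fun j => R.obj (Z j) (W j)) L hL ≫
        compHom P Q I (A' := fun j => R.obj (compObj P Q I A X j) (compObj P Q I B Y j))
          (fun j => compInter g f A B X Y j) (𝟙 (fun j => R.obj (Z j) (W j) : Collection C)) j ≫
        compInter g f (compObj P Q I A X) (compObj P Q I B Y) Z W j =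
      P.hom (P.hom (𝟙 _) (tensInter f X Y (L.map List.length))) (tensInter f Z W L.flatten) ≫
        P.hom (g.η _ _ _ _) (𝟙 _) ≫ g.η _ _ _ _ ≫
        R.hom (compCompι P Q I A X Z L hL) (compCompι P Q I B Y W L hL) := by
    rw [compCompι, Category.assoc, reassoc_of% h₁, h₄, P.comp_hom_assoc, P.comp_hom_assoc, h₃,
      compCompι, compCompι, R.hom_comp, ← g.η_naturality_assoc, P.comp_hom_assoc,
      P.comp_hom_assoc, tensMap_id, R.hom_id]
    simp only [Category.id_comp, Category.comp_id, Category.assoc]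
  rw [reassoc_of% lhs, R.comp_hom, c₂, c₃, R.hom_comp, reassoc_of% h₆, MP.assoc_naturality_assoc,
    reassoc_of% c₁, reassoc_of% h₂, h₅, R.hom_comp, ← g.η_naturality_assoc, hom_castHom,
    P.comp_hom_assoc, P.comp_hom_assoc, P.comp_hom_assoc, P.comp_hom_assoc]
  simp only [Category.assoc]
  rw [h₇]
  simp only [Category.id_comp, Category.comp_id, Pi.id_apply]

/-- The external associativity condition. -/
theorem compInter_external_assoc (hf : f.Normal MQ MR) (hg : g.Normal MP MR)
    (A B X Y Z W : Collection C) (j : ℕ) :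
    compInter g f (fun j => R.obj (A j) (B j)) X (fun j => R.obj (Y j) (Z j)) W j ≫
        R.hom (compInter g f A B Y Z j) (𝟙 (compObj P Q I X W j)) ≫ MR.assoc _ _ _ =
      compHom P Q I (A := fun j => R.obj (R.obj (A j) (B j)) (X j))
          (A' := fun j => R.obj (A j) (R.obj (B j) (X j)))
          (B := fun j => R.obj (R.obj (Y j) (Z j)) (W j))
          (B' := fun j => R.obj (Y j) (R.obj (Z j) (W j)))
          (fun j => MR.assoc (A j) (B j) (X j)) (fun j => MR.assoc (Y j) (Z j) (W j)) j ≫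
        compInter g f A (fun j => R.obj (B j) (X j)) Y (fun j => R.obj (Z j) (W j)) j ≫
        R.hom (𝟙 (compObj P Q I A Y j)) (compInter g f B X Z W j) := by
  refine compObj_hom_ext P Q I fun l h => ?_
  have h₁ := compι_compInter g f (fun j => R.obj (A j) (B j)) X (fun j => R.obj (Y j) (Z j)) W l h
  have h₂ := compι_compInter g f A (fun j => R.obj (B j) (X j)) Y (fun j => R.obj (Z j) (W j)) l h
  have h₃ := compι_compInter g f A B Y Z l h
  have h₄ := compι_compInter g f B X Z W l h
  have h₅ := compι_compHom P Q I (A := fun j => R.obj (R.obj (A j) (B j)) (X j))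
          (A' := fun j => R.obj (A j) (R.obj (B j) (X j)))
          (B := fun j => R.obj (R.obj (Y j) (Z j)) (W j))
          (B' := fun j => R.obj (Y j) (R.obj (Z j) (W j)))
          (fun j => MR.assoc (A j) (B j) (X j)) (fun j => MR.assoc (Y j) (Z j) (W j)) l h
  have h₆ := hg.external_assoc (A l.length) (B l.length) (X l.length) (tens Q I Y l) (tens Q I Z l)
    (tens Q I W l)
  have h₇ := tensInter_assoc hf Y Z W l
  have e₁ : R.hom (P.hom (𝟙 (R.obj (A l.length) (B l.length))) (tensInter f Y Z l) ≫
        g.η _ _ _ _ ≫ R.hom (compι P Q I A Y l h) (compι P Q I B Z l h)) (compι P Q I X W l h) =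
      R.hom (P.hom (𝟙 _) (tensInter f Y Z l)) (P.hom (𝟙 _) (𝟙 _)) ≫ R.hom (g.η _ _ _ _) (𝟙 _) ≫
        R.hom (R.hom (compι P Q I A Y l h) (compι P Q I B Z l h)) (compι P Q I X W l h) := by
    rw [R.comp_hom, R.comp_hom, P.hom_id, Category.id_comp, Category.id_comp]
  have e₂ : R.hom (compι P Q I A Y l h) (P.hom (𝟙 (R.obj (B l.length) (X l.length)))
        (tensInter f Z W l) ≫ g.η _ _ _ _ ≫
        R.hom (compι P Q I B Z l h) (compι P Q I X W l h)) =
      R.hom (P.hom (𝟙 _) (𝟙 _)) (P.hom (𝟙 _) (tensInter f Z W l)) ≫ R.hom (𝟙 _) (g.η _ _ _ _) ≫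
        R.hom (compι P Q I A Y l h) (R.hom (compι P Q I B Z l h) (compι P Q I X W l h)) := by
    rw [R.comp_hom, R.comp_hom, P.hom_id, Category.id_comp, Category.id_comp]
  rw [reassoc_of% h₁, reassoc_of% h₅, reassoc_of% h₂, R.comp_hom_assoc, R.comp_hom, h₃, h₄,
    Category.comp_id, Category.comp_id, e₁, e₂, ← g.η_naturality_assoc]
  simp only [Category.assoc]
  rw [← g.η_naturality_assoc, MR.assoc_naturality, reassoc_of% h₆, P.comp_hom_assoc,
    P.comp_hom_assoc, P.comp_hom_assoc, P.comp_hom_assoc, Category.assoc, Category.assoc, h₇]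
  simp only [R.hom_id, Category.id_comp, Category.comp_id, Category.assoc]

/-- The interchange from the composition product inherits the giant hexagon. -/
theorem compInter_hexagon {R' : Product C} {f' : Interchange Q I R' I} {g' : Interchange P I R' I}
    {k : Interchange R I R' I} {MR' : LaxMonoidal R' I} (hf : f.Normal MQ MR)
    (hf' : f'.Normal MQ MR') (hk : k.Normal MR MR') (h : Hexagon f k f') (h' : Hexagon g k g')
    (A A' B B' X X' Y Y' : Collection C) (j : ℕ) :
    compHom P Q I (A := fun j => R.obj (R'.obj (A j) (A' j)) (R'.obj (B j) (B' j)))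
          (A' := fun j => R'.obj (R.obj (A j) (B j)) (R.obj (A' j) (B' j)))
          (B := fun j => R.obj (R'.obj (X j) (X' j)) (R'.obj (Y j) (Y' j)))
          (B' := fun j => R'.obj (R.obj (X j) (Y j)) (R.obj (X' j) (Y' j)))
          (fun j => k.η (A j) (A' j) (B j) (B' j)) (fun j => k.η (X j) (X' j) (Y j) (Y' j)) j ≫
        compInter g' f' (fun j => R.obj (A j) (B j)) (fun j => R.obj (A' j) (B' j))
          (fun j => R.obj (X j) (Y j)) (fun j => R.obj (X' j) (Y' j)) j ≫
        R'.hom (compInter g f A B X Y j) (compInter g f A' B' X' Y' j) =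
      compInter g f (fun j => R'.obj (A j) (A' j)) (fun j => R'.obj (B j) (B' j))
          (fun j => R'.obj (X j) (X' j)) (fun j => R'.obj (Y j) (Y' j)) j ≫
        R.hom (compInter g' f' A A' X X' j) (compInter g' f' B B' Y Y' j) ≫
        k.η (compObj P Q I A X j) (compObj P Q I A' X' j) (compObj P Q I B Y j)
          (compObj P Q I B' Y' j) := by
  refine compObj_hom_ext P Q I fun l hl => ?_
  have h₁ := compι_compHom P Q I (A := fun j => R.obj (R'.obj (A j) (A' j)) (R'.obj (B j) (B' j)))
          (A' := fun j => R'.obj (R.obj (A j) (B j)) (R.obj (A' j) (B' j)))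
          (B := fun j => R.obj (R'.obj (X j) (X' j)) (R'.obj (Y j) (Y' j)))
          (B' := fun j => R'.obj (R.obj (X j) (Y j)) (R.obj (X' j) (Y' j)))
    (fun j => k.η (A j) (A' j) (B j) (B' j)) (fun j => k.η (X j) (X' j) (Y j) (Y' j)) l hl
  have h₂ := compι_compInter g' f' (fun j => R.obj (A j) (B j)) (fun j => R.obj (A' j) (B' j))
          (fun j => R.obj (X j) (Y j)) (fun j => R.obj (X' j) (Y' j)) l hl
  have h₃ := compι_compInter g f (fun j => R'.obj (A j) (A' j)) (fun j => R'.obj (B j) (B' j))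
          (fun j => R'.obj (X j) (X' j)) (fun j => R'.obj (Y j) (Y' j)) l hl
  have h₄ := tensInter_hexagon hf hf' hk h X X' Y Y' l
  have h₅ := h' (A l.length) (A' l.length) (B l.length) (B' l.length) (tens Q I X l)
    (tens Q I X' l) (tens Q I Y l) (tens Q I Y' l)
  rw [reassoc_of% h₁, reassoc_of% h₂, reassoc_of% h₃, R'.comp_hom, R.comp_hom_assoc,
    compι_compInter, compι_compInter, compι_compInter, compι_compInter, R'.hom_comp, R'.hom_comp,
    R.hom_comp, R.hom_comp, ← g'.η_naturality_assoc, Category.assoc, Category.assoc,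
    ← g.η_naturality_assoc, k.η_naturality, ← reassoc_of% h₅, P.comp_hom_assoc, P.comp_hom_assoc,
    P.comp_hom_assoc, P.comp_hom_assoc]
  simp only [Category.assoc]
  rw [h₄]
  simp only [R.hom_id, R'.hom_id, Category.id_comp, Category.comp_id]

end CompInterchange

/-! ### Levelwise structures -/

section Level

variable {S T R : Product C} {I : C}

/-- The levelwise lax monoidal structure on collections. -/
def levelLaxMonoidal (M : LaxMonoidal T I) :
    LaxMonoidal (levelProduct T) (constCollection I) where
  assoc A B D := fun j => M.assoc (A j) (B j) (D j)
  leftUnitor A := Pi.isoMk fun j => M.leftUnitor (A j)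
  rightUnitor A := Pi.isoMk fun j => M.rightUnitor (A j)
  assoc_naturality f g h := funext fun j => M.assoc_naturality (f j) (g j) (h j)
  leftUnitor_naturality f := funext fun j => M.leftUnitor_naturality (f j)
  rightUnitor_naturality f := funext fun j => M.rightUnitor_naturality (f j)
  pentagon A B D E := funext fun j => M.pentagon (A j) (B j) (D j) (E j)
  triangle A B := funext fun j => M.triangle (A j) (B j)
  triangle_left A B := funext fun j => M.triangle_left (A j) (B j)
  triangle_right A B := funext fun j => M.triangle_right (A j) (B j)

/-- The levelwise interchange between two levelwise products. -/
def levelInterchange (e : Interchange S I T I) :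
    Interchange (levelProduct S) (constCollection I) (levelProduct T) (constCollection I) where
  η A B D E := fun j => e.η (A j) (B j) (D j) (E j)
  η_naturality f g h k := funext fun j => e.η_naturality (f j) (g j) (h j) (k j)
  δ := fun _ => e.δ
  μ := fun _ => e.μ

theorem levelInterchange_coherent {e : Interchange S I T I} {M : LaxMonoidal S I}
    {N : LaxMonoidal T I} (he : e.Coherent M N) :
    (levelInterchange e).Coherent (levelLaxMonoidal M) (levelLaxMonoidal N) where
  internal_unit_right A B := funext fun j => he.internal_unit_right (A j) (B j)
  internal_unit_left A B := funext fun j => he.internal_unit_left (A j) (B j)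
  external_unit_right A B := funext fun j => he.external_unit_right (A j) (B j)
  external_unit_left A B := funext fun j => he.external_unit_left (A j) (B j)
  internal_assoc A B X Y Z W :=
    funext fun j => he.internal_assoc (A j) (B j) (X j) (Y j) (Z j) (W j)
  external_assoc A B X Y Z W :=
    funext fun j => he.external_assoc (A j) (B j) (X j) (Y j) (Z j) (W j)

theorem levelInterchange_hexagon {e : Interchange S I T I} {f : Interchange T I R I}
    {g : Interchange S I R I} (h : Hexagon e f g) :
    Hexagon (levelInterchange e) (levelInterchange f) (levelInterchange g) :=
  fun A A' B B' X X' Y Y' =>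
    funext fun j => h (A j) (A' j) (B j) (B' j) (X j) (X' j) (Y j) (Y' j)

theorem isIso_pi {A B : Collection C} (f : A ⟶ B) (h : ∀ j, IsIso (f j)) : IsIso f :=
  ⟨fun j => inv (f j), funext fun j => IsIso.hom_inv_id (f j),
    funext fun j => IsIso.inv_hom_id (f j)⟩

theorem IteratedMonoidal.normal {n : ℕ} (V : IteratedMonoidal n C) (i j : Fin n) (h : i < j) :
    (V.str.ic i j h).Normal (V.str.mon i) (V.str.mon j) :=
  { V.str.coherent i j h with
    δ_eq := V.δ_eq i j h
    μ_eq := V.μ_eq i j h }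

/-- The index of the product `⊗_{m-1}`. -/
def outer {n : ℕ} (m : ℕ) (hm : 2 ≤ m) (hmn : m ≤ n) : Fin n := ⟨m - 2, by omega⟩

/-- The index of the product `⊗_m`. -/
def inner {n : ℕ} (m : ℕ) (hm : 2 ≤ m) (hmn : m ≤ n) : Fin n := ⟨m - 1, by omega⟩

theorem outer_lt_inner {n : ℕ} (m : ℕ) (hm : 2 ≤ m) (hmn : m ≤ n) :
    outer m hm hmn < inner m hm hmn :=
  Fin.mk_lt_mk.mpr (by omega)

theorem outer_lt_upper {n : ℕ} (V : IteratedMonoidal n C) (m : ℕ) (hm : 2 ≤ m) (hmn : m ≤ n)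
    (i : Fin (n - m)) : outer m hm hmn < V.upper m i :=
  Fin.mk_lt_mk.mpr (by omega)

theorem inner_lt_upper {n : ℕ} (V : IteratedMonoidal n C) (m : ℕ) (hm : 2 ≤ m) (hmn : m ≤ n)
    (i : Fin (n - m)) : inner m hm hmn < V.upper m i :=
  Fin.mk_lt_mk.mpr (by omega)

end Level

/-! ### The iterated lax monoidal category of collections -/

section Collections

variable [HasCoproducts.{0} C] {P Q R R' : Product C} {I : C}

/-- The interchange, with its unit comparisons, from the composition product to a levelwise
product. -/
noncomputable def compInterchange (MP : LaxMonoidal P I) (MQ : LaxMonoidal Q I)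
    (MR : LaxMonoidal R I) (hR : R.PreservesCoproducts) (g : Interchange P I R I)
    (f : Interchange Q I R I) :
    Interchange (compProduct P Q I) (unitCollection I) (levelProduct R) (constCollection I) where
  η A B D E := fun j => compInter g f A B D E j
  η_naturality a b d e := funext fun j => compInter_naturality g f a b d e j
  δ := (exists_compUnit_comparison MR hR).choose
  μ := fun j => compMu MP MQ j

theorem compInterchange_coherent {e : Interchange P I Q I} {f : Interchange Q I R I}
    {g : Interchange P I R I} {MP : LaxMonoidal P I} {MQ : LaxMonoidal Q I} {MR : LaxMonoidal R I}
    (hM : ∀ X Y Z, IsIso (MQ.assoc X Y Z)) (he : e.Normal MP MQ) (hf : f.Normal MQ MR)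
    (hg : g.Normal MP MR) (h : Hexagon e f g) (hP : P.PreservesCoproducts)
    (hQ : Q.PreservesCoproducts) (hR : R.PreservesCoproducts) :
    (compInterchange MP MQ MR hR g f).Coherent (compLaxMonoidal hM he hP hQ)
      (levelLaxMonoidal MR) where
  internal_unit_right A B := funext fun j =>
    compInter_unit_right hP hQ hf hg _ (exists_compUnit_comparison MR hR).choose_spec.2 A B j
  internal_unit_left A B := funext fun j =>
    compInter_unit_left hP hf hg _ (exists_compUnit_comparison MR hR).choose_spec.2 A B j
  external_unit_right A B := funext fun j => compInter_const_right hf hg A B j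
  external_unit_left A B := funext fun j => compInter_const_left hf hg A B j
  internal_assoc A B X Y Z W := funext fun j =>
    compInter_internal_assoc he hf hg hM h hP A B X Y Z W j
  external_assoc A B X Y Z W := funext fun j => compInter_external_assoc hf hg A B X Y Z W j

theorem compInterchange_inducedBy (MP : LaxMonoidal P I) (MQ : LaxMonoidal Q I)
    (MR : LaxMonoidal R I) (hR : R.PreservesCoproducts) (g : Interchange P I R I)
    (f : Interchange Q I R I) : InterchangeInducedBy g f (compInterchange MP MQ MR hR g f) := by
  intro A B D E l j h
  rw [tensInterchange_eq_tensInter]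
  exact compι_compInter g f A B D E l h

theorem isIso_compInterchange_δ (MP : LaxMonoidal P I) (MQ : LaxMonoidal Q I)
    (MR : LaxMonoidal R I) (hR : R.PreservesCoproducts) (g : Interchange P I R I)
    (f : Interchange Q I R I) : IsIso (compInterchange MP MQ MR hR g f).δ :=
  isIso_pi _ (exists_compUnit_comparison MR hR).choose_spec.1

/-- If any two maps out of `I` with the same target agree, then a coproduct of copies of `I` over
a nonempty index set is isomorphic to `I`. The index set is nonempty because it contains `[j]`. -/
theorem isIso_compMu (MP : LaxMonoidal P I) (MQ : LaxMonoidal Q I)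
    (hI : ∀ (X : C) (a b : I ⟶ X), a = b) (j : ℕ) : IsIso (compMu MP MQ j) := by
  have hs (l : List ℕ) : IsIso (P.hom (𝟙 I) (tensConst MQ l) ≫ (MP.leftUnitor I).hom) :=
    inferInstance
  refine ⟨inv (P.hom (𝟙 I) (tensConst MQ [j]) ≫ (MP.leftUnitor I).hom) ≫
    compι P Q I (constCollection I) (constCollection I) [j] List.sum_singleton, ?_, hI _ _ _⟩
  refine compObj_hom_ext P Q I fun l h => ?_
  refine ((reassoc_of% (compι_compMu MP MQ l h)) _).trans ?_
  refine (congrArg (fun s => (P.hom (𝟙 I) (tensConst MQ l) ≫ (MP.leftUnitor I).hom) ≫ s)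
    (hI _ _ (inv (P.hom (𝟙 I) (tensConst MQ l) ≫ (MP.leftUnitor I).hom) ≫
      compι P Q I (constCollection I) (constCollection I) l h))).trans ?_
  refine (IsIso.hom_inv_id_assoc _ _).trans ?_
  exact (Category.comp_id _).symm

theorem compInterchange_hexagon {f : Interchange Q I R I} {g : Interchange P I R I}
    {f' : Interchange Q I R' I} {g' : Interchange P I R' I} {k : Interchange R I R' I}
    {MP : LaxMonoidal P I} {MQ : LaxMonoidal Q I} {MR : LaxMonoidal R I} {MR' : LaxMonoidal R' I}
    (hR : R.PreservesCoproducts) (hR' : R'.PreservesCoproducts) (hf : f.Normal MQ MR)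
    (hf' : f'.Normal MQ MR') (hk : k.Normal MR MR') (h : Hexagon f k f') (h' : Hexagon g k g') :
    Hexagon (compInterchange MP MQ MR hR g f) (levelInterchange k)
      (compInterchange MP MQ MR' hR' g' f') :=
  fun A A' B B' X X' Y Y' => funext fun j =>
    compInter_hexagon hf hf' hk h h' A A' B B' X X' Y Y' j

section Structure

variable {n : ℕ} (V : IteratedMonoidal n C) (hV : V.PreservesCoproducts) (m : ℕ) (hm : 2 ≤ m)
  (hmn : m ≤ n)

/-- The lax monoidal structures on collections. -/
noncomputable def colMon :
    ∀ i, LaxMonoidal (V.colProducts m hm hmn i) (V.colUnits m i) :=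
  Fin.cases
    (compLaxMonoidal (V.assoc_isIso (inner m hm hmn))
      (V.normal (outer m hm hmn) (inner m hm hmn) (outer_lt_inner m hm hmn))
      (hV (outer m hm hmn)) (hV (inner m hm hmn)))
    fun i => levelLaxMonoidal (V.str.mon (V.upper m i))

/-- The interchanges on collections. -/
noncomputable def colInterchange : ∀ i j, i < j →
    Interchange (V.colProducts m hm hmn i) (V.colUnits m i) (V.colProducts m hm hmn j)
      (V.colUnits m j) :=
  Fin.cases
    (Fin.cases (fun h => absurd h (lt_irrefl 0)) fun j _ =>
      compInterchange (V.str.mon (outer m hm hmn)) (V.str.mon (inner m hm hmn))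
        (V.str.mon (V.upper m j)) (hV (V.upper m j))
        (V.str.ic _ _ (outer_lt_upper V m hm hmn j)) (V.str.ic _ _ (inner_lt_upper V m hm hmn j)))
    fun _ => Fin.cases (fun h => absurd h (Fin.not_lt_zero _)) fun _ h =>
      levelInterchange (V.str.ic _ _ (V.upper_lt m (Fin.succ_lt_succ_iff.mp h)))

/-- The iterated lax monoidal structure on collections. -/
noncomputable def colStructure : LaxIterated (V.colProducts m hm hmn) (V.colUnits m) where
  mon := colMon V hV m hm hmn
  ic := colInterchange V hV m hm hmn
  coherent := by
    refine Fin.cases (Fin.cases (fun h => absurd h (lt_irrefl 0)) fun j _ => ?_)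
      fun _ => Fin.cases (fun h => absurd h (Fin.not_lt_zero _)) fun _ _ => ?_
    · exact compInterchange_coherent (V.assoc_isIso (inner m hm hmn))
        (V.normal _ _ (outer_lt_inner m hm hmn)) (V.normal _ _ (inner_lt_upper V m hm hmn j))
        (V.normal _ _ (outer_lt_upper V m hm hmn j)) (V.str.hexagon _ _ _ _ _)
        (hV (outer m hm hmn)) (hV (inner m hm hmn)) (hV (V.upper m j))
    · exact levelInterchange_coherent (V.str.coherent _ _ _)
  hexagon := by
    refine fun i j k hij hjk => ?_
    obtain ⟨j, rfl⟩ := Fin.exists_succ_eq.mpr (Fin.ne_zero_of_lt hij)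
    obtain ⟨k, rfl⟩ := Fin.exists_succ_eq.mpr (Fin.ne_zero_of_lt hjk)
    induction i using Fin.cases with
    | zero =>
      exact compInterchange_hexagon (hV _) (hV _) (V.normal _ _ _) (V.normal _ _ _)
        (V.normal _ _ (V.upper_lt m (Fin.succ_lt_succ_iff.mp hjk)))
        (V.str.hexagon _ _ _ _ _) (V.str.hexagon _ _ _ _ _)
    | succ i => exact levelInterchange_hexagon (V.str.hexagon _ _ _ _ _)

end Structure

end Collections

/-! ### The comparison maps `μ` -/

section Mu

variable [HasCoproducts.{0} C] {R : Product C} {I : C}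

/-- The interchange from the coproduct to `R` is forced to be the canonical one by its unit axioms,
so its comparison map `I ⊔ I ⟶ I` is the codiagonal. -/
theorem coprod_comparison {M : LaxMonoidal (coprodProduct C) (⊥_ C)} {N : LaxMonoidal R I}
    {e : Interchange (coprodProduct C) (⊥_ C) R I} (he : e.Coherent M N)
    (hl : ∀ X, M.leftUnitor X = coprod.leftUnitor X)
    (hr : ∀ X, M.rightUnitor X = coprod.rightUnitor X) :
    coprod.inl ≫ e.μ = 𝟙 I ∧ coprod.inr ≫ e.μ = 𝟙 I := by
  suffices H : ∀ (η : ∀ A B Z W : C, R.obj A B ⨿ R.obj Z W ⟶ R.obj (A ⨿ Z) (B ⨿ W))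
      (δ : ⊥_ C ⟶ R.obj (⊥_ C) (⊥_ C)) (μ : I ⨿ I ⟶ I),
      (∀ A B {X Z Y W : C} (h : X ⟶ Z) (k : Y ⟶ W),
        coprod.map (R.hom (𝟙 A) (𝟙 B)) (R.hom h k) ≫ η A B Z W =
          η A B X Y ≫ R.hom (coprod.map (𝟙 A) h) (coprod.map (𝟙 B) k)) →
      (∀ A B {X Z Y W : C} (h : X ⟶ Z) (k : Y ⟶ W),
        coprod.map (R.hom h k) (R.hom (𝟙 A) (𝟙 B)) ≫ η Z W A B =
          η X Y A B ≫ R.hom (coprod.map h (𝟙 A)) (coprod.map k (𝟙 B))) →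
      (∀ A B, coprod.map (𝟙 (R.obj A B)) δ ≫ η A B (⊥_ C) (⊥_ C) ≫
        R.hom (M.rightUnitor A).hom (M.rightUnitor B).hom = (M.rightUnitor (R.obj A B)).hom) →
      (∀ A B, coprod.map δ (𝟙 (R.obj A B)) ≫ η (⊥_ C) (⊥_ C) A B ≫
        R.hom (M.leftUnitor A).hom (M.leftUnitor B).hom = (M.leftUnitor (R.obj A B)).hom) →
      (η I I I I ≫ R.hom μ (𝟙 (I ⨿ I)) ≫ (N.leftUnitor (I ⨿ I)).hom =
        coprod.map (N.leftUnitor I).hom (N.leftUnitor I).hom) →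
      coprod.inl ≫ μ = 𝟙 I ∧ coprod.inr ≫ μ = 𝟙 I from
    H e.η e.δ e.μ (fun A B _ _ _ _ h k => e.η_naturality (𝟙 A) (𝟙 B) h k)
      (fun A B _ _ _ _ h k => e.η_naturality h k (𝟙 A) (𝟙 B)) he.internal_unit_right
      he.internal_unit_left (he.external_unit_left I I)
  intro η δ μ nat_right nat_left unit_right unit_left h
  -- On a summand the interchange is the tensor product of the inclusions: if the other summand is
  -- `∅ ⊗ ∅`, this is an internal unit axiom, and in general it follows by naturality.
  have inl_η (A B Z W : C) : coprod.inl ≫ η A B Z W = R.hom coprod.inl coprod.inl := by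
    have h1 := congrArg (fun s => coprod.inl ≫ s) (unit_right A B)
    have h2 := congrArg (fun s => coprod.inl ≫ s) (nat_right A B (initial.to Z) (initial.to W))
    simp only [hr, coprod.rightUnitor_hom, coprod.inl_map_assoc, R.hom_id, Category.id_comp,
      coprod.inl_desc] at h1 h2
    have h3 (X Y : C) : coprod.map (𝟙 X) (initial.to Y) =
        coprod.desc (𝟙 X) (initial.to X) ≫ coprod.inl :=
      coprod.hom_ext (by rw [coprod.inl_map, coprod.inl_desc_assoc]) (initialIsInitial.hom_ext _ _)
    rw [h2, h3, h3, ← R.comp_hom, reassoc_of% h1]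
  have inr_η (A B Z W : C) : coprod.inr ≫ η Z W A B = R.hom coprod.inr coprod.inr := by
    have h1 := congrArg (fun s => coprod.inr ≫ s) (unit_left A B)
    have h2 := congrArg (fun s => coprod.inr ≫ s) (nat_left A B (initial.to Z) (initial.to W))
    simp only [hl, coprod.leftUnitor_hom, coprod.inr_map_assoc, R.hom_id, Category.id_comp,
      coprod.inr_desc] at h1 h2
    have h3 (X Y : C) : coprod.map (initial.to Y) (𝟙 X) =
        coprod.desc (initial.to X) (𝟙 X) ≫ coprod.inr :=
      coprod.hom_ext (initialIsInitial.hom_ext _ _) (by rw [coprod.inr_map, coprod.inr_desc_assoc])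
    rw [h2, h3, h3, ← R.comp_hom, reassoc_of% h1]
  have key (i : I ⟶ I ⨿ I) [Mono i]
      (hi : R.hom (i ≫ μ) i ≫ (N.leftUnitor (I ⨿ I)).hom = (N.leftUnitor I).hom ≫ i) :
      i ≫ μ = 𝟙 I := by
    have h1 : R.hom (i ≫ μ) i = R.hom (i ≫ μ) (𝟙 I) ≫ R.hom (𝟙 I) i := by
      rw [R.comp_hom, Category.id_comp, Category.comp_id]
    rw [h1, Category.assoc, N.leftUnitor_naturality, ← Category.assoc, cancel_mono] at hi
    refine N.hom_id_injective ?_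
    rw [R.hom_id, ← cancel_mono (N.leftUnitor I).hom, hi, Category.id_comp]
  constructor
  · have : Mono (coprod.inl : I ⟶ I ⨿ I) :=
      mono_of_mono_fac (coprod.inl_desc (𝟙 I) (𝟙 I))
    refine key _ ?_
    have h1 := congrArg (fun s => coprod.inl ≫ s) h
    simp only [coprod.inl_map, reassoc_of% (inl_η I I I I), R.comp_hom_assoc,
      Category.comp_id] at h1
    exact h1
  · have : Mono (coprod.inr : I ⟶ I ⨿ I) :=
      mono_of_mono_fac (coprod.inr_desc (𝟙 I) (𝟙 I))
    refine key _ ?_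
    have h1 := congrArg (fun s => coprod.inr ≫ s) h
    simp only [coprod.inr_map, reassoc_of% (inr_η I I I I), R.comp_hom_assoc,
      Category.comp_id] at h1
    exact h1

/-- If the codiagonal of `I` is an isomorphism, then any two maps out of `I` agree. -/
theorem hom_ext_of_isIso_comparison {μ : I ⨿ I ⟶ I}
    (h : coprod.inl ≫ μ = 𝟙 I ∧ coprod.inr ≫ μ = 𝟙 I) [IsIso μ] {X : C} (a b : I ⟶ X) :
    a = b := by
  have h1 : (coprod.inl : I ⟶ I ⨿ I) = coprod.inr := by
    rw [← cancel_mono μ, h.1, h.2]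
  rw [← coprod.inl_desc a b, h1, coprod.inr_desc]

end Mu

end IterMon

theorem mainTheorem2 {C : Type u} [Category.{v} C] [HasCoproducts.{0} C] (n m : ℕ)
    (hm : 2 ≤ m) (hmn : m ≤ n) (V : IterMon.IteratedMonoidal n C)
    (hV : V.PreservesCoproducts) (W : V.CoproductExtension) :
    ∃ S : IterMon.LaxIterated (V.colProducts m hm hmn) (V.colUnits m),
      IterMon.AssocInducedBy (V.str.mon ⟨m - 2, by omega⟩) (V.str.mon ⟨m - 1, by omega⟩)
        (V.assoc_isIso ⟨m - 1, by omega⟩)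
        (V.str.ic ⟨m - 2, by omega⟩ ⟨m - 1, by omega⟩ (Fin.mk_lt_mk.mpr (by omega)))
        (S.mon 0) ∧
      (∀ i : Fin (n - m), IterMon.MonLevelwise (V.str.mon (V.upper m i)) (S.mon i.succ)) ∧
      (∀ i : Fin (n - m), IterMon.InterchangeInducedBy
        (V.str.ic ⟨m - 2, by omega⟩ (V.upper m i)
          (Fin.mk_lt_mk.mpr (by omega)))
        (V.str.ic ⟨m - 1, by omega⟩ (V.upper m i)
          (Fin.mk_lt_mk.mpr (by omega)))
        (S.ic 0 i.succ (Fin.succ_pos i))) ∧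
      (∀ (i j : Fin (n - m)) (h : i < j), IterMon.InterchangeLevelwise
        (V.str.ic (V.upper m i) (V.upper m j) (V.upper_lt m h))
        (S.ic i.succ j.succ (Fin.succ_lt_succ_iff.mpr h))) ∧
      (∀ i j h, IsIso (S.ic i j h).δ) ∧
      ((∀ i j h, IsIso (W.str.ic i j h).μ) → ∀ i j h, IsIso (S.ic i j h).μ) := by
  refine ⟨IterMon.colStructure V hV m hm hmn, fun A B D L j h => ?_,
    fun i => ⟨fun _ _ _ _ => rfl, fun _ _ => rfl, fun _ _ => rfl⟩,
    fun i => IterMon.compInterchange_inducedBy _ _ _ (hV _) _ _,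
    fun i j h => ⟨fun _ _ _ _ _ => rfl, fun _ => rfl, fun _ => rfl⟩, ?_, fun hW => ?_⟩
  · exact (Category.assoc _ _ _).symm.trans
      (IterMon.compCompι_compAssoc _ _ _ _ (hV _) A B D L h)
  · intro i j h
    obtain ⟨j, rfl⟩ := Fin.exists_succ_eq.mpr (Fin.ne_zero_of_lt h)
    induction i using Fin.cases with
    | zero => exact IterMon.isIso_compInterchange_δ _ _ _ (hV _) _ _
    | succ i =>
      refine IterMon.isIso_pi _ fun k => ?_
      have h1 := V.δ_eq _ _ (V.upper_lt m (Fin.succ_lt_succ_iff.mp h))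
      have h2 : IsIso (V.str.ic _ _ (V.upper_lt m (Fin.succ_lt_succ_iff.mp h))).δ := by
        rw [h1]; infer_instance
      exact h2
  · intro i j h
    obtain ⟨j, rfl⟩ := Fin.exists_succ_eq.mpr (Fin.ne_zero_of_lt h)
    induction i using Fin.cases with
    | zero =>
      -- Since `j` is an index of one of `⊗_{m+1}, …, ⊗_n`, the product `⊗₃` exists.
      let k : Fin (n - 2) := ⟨0, by have := j.isLt; omega⟩
      have h1 := IterMon.coprod_comparison (W.str.coherent 0 k.succ (Fin.succ_pos k))
        W.leftUnitor_zero W.rightUnitor_zero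
      have h2 := hW 0 k.succ (Fin.succ_pos k)
      exact IterMon.isIso_pi _ fun l => IterMon.isIso_compMu _ _
        (fun X a b => @IterMon.hom_ext_of_isIso_comparison _ _ _ _ _ h1 h2 X a b) l
    | succ i =>
      refine IterMon.isIso_pi _ fun k => ?_
      have h1 := V.μ_eq _ _ (V.upper_lt m (Fin.succ_lt_succ_iff.mp h))
      have h2 : IsIso (V.str.ic _ _ (V.upper_lt m (Fin.succ_lt_succ_iff.mp h))).μ := by
        rw [h1]; infer_instance
      exact h2
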